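/- **Theorem (Spectral Theorem: Bounded Operators, $\mathbb{K}=\mathbb{R}$).** Let $A_1,\dots,A_d$ be bounded, self-adjoint, pairwise commuting operators on a real Hilbert space $H$. Then there is a unique Borel calculus $(\Phi,H)$ on $\mathbb{R}^d$ such that $\Phi(\mathbf{z}_j)=A_j$ for all $j=1,\dots,d$, where $\mathbf{z}_j:\mathbb{R}^d\to\mathbb{R}$ is the $j$-th coordinate function. Here a Borel calculus $(\Phi,H)$ on $\mathbb{R}^d$ is a map $\Phi$ from the algebra $\mathcal{M}(\mathbb{R}^d)$ of all Borel measurable functions $f:\mathbb{R}^d\to\mathbb{R}$ to the set of closed (not necessarily bounded or everywhere defined) linear operators in $H$ such that, for all $f,g\in\mathcal{M}(\mathbb{R}^d)$ and $\lambda\in\mathbb{R}$ (with $\subseteq$ denoting inclusion of graphs and with sums and products of operators taken on their natural domains): 1. $\Phi(\mathbf{1})=\mathrm{I}$; 2. $\Phi(f)+\Phi(g)\subseteq\Phi(f+g)$ and $\lambda\Phi(f)\subseteq\Phi(\lambda f)$; 3. $\Phi(f)\Phi(g)\subseteq\Phi(fg)$ and $\operatorname{dom}(\Phi(f)\Phi(g))=\operatorname{dom}(\Phi(g))\cap\operatorname{dom}(\Phi(fg))$;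 4. if $f$ is bounded, then $\Phi(f)$ is a bounded, everywhere defined operator and $\Phi(f)^*=\Phi(f)$; 5. if $f_n\to f$ pointwise with $\sup_n\|f_n\|_\infty<\infty$, then $\Phi(f_n)\to\Phi(f)$ in the weak operator topology. -/

import Mathlib

open Filter Topology

namespace SpectralCalculus

/-- The unital *-algebra `M(X, Σ)` of all measurable scalar functions on a measurable space,
with the pointwise operations. -/
def MeasurableFunctions (𝕜 : Type*) [RCLike 𝕜] [MeasurableSpace 𝕜] [BorelSpace 𝕜]
    (X : Type*) [MeasurableSpace X] :
    StarSubalgebra 𝕜 (X → 𝕜) where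
  carrier := {f | Measurable f}
  mul_mem' hf hg := Measurable.mul hf hg
  add_mem' hf hg := Measurable.add hf hg
  algebraMap_mem' _ := measurable_const
  star_mem' hf := RCLike.continuous_conj.measurable.comp hf

/-- A bounded operator, regarded as an everywhere defined partial operator. -/
def ofBounded {𝕜 H : Type*} [RCLike 𝕜] [NormedAddCommGroup H] [InnerProductSpace 𝕜 H]
    (T : H →L[𝕜] H) : H →ₗ.[𝕜] H :=
  (T : H →ₗ[𝕜] H).toPMap ⊤

/-- The subspace of those `x ∈ dom S` with `S x ∈ dom R`. -/
def compDomain {𝕜 H : Type*} [RCLike 𝕜] [NormedAddCommGroup H] [InnerProductSpace 𝕜 H]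
    (R S : H →ₗ.[𝕜] H) : Submodule 𝕜 H :=
  (R.domain.comap S.toFun).map S.domain.subtype

theorem mem_compDomain {𝕜 H : Type*} [RCLike 𝕜] [NormedAddCommGroup H] [InnerProductSpace 𝕜 H]
    (R S : H →ₗ.[𝕜] H) (x : H) :
    x ∈ compDomain R S ↔ ∃ h : x ∈ S.domain, S ⟨x, h⟩ ∈ R.domain := by
  simp only [compDomain, Submodule.mem_map, Submodule.mem_comap]
  constructor
  · rintro ⟨y, hy, rfl⟩
    exact ⟨y.2, hy⟩
  · rintro ⟨h, hx⟩
    exact ⟨⟨x, h⟩, hx, rfl⟩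

/-- The composition `R S` of two partial operators, with its natural domain. -/
noncomputable def comp {𝕜 H : Type*} [RCLike 𝕜] [NormedAddCommGroup H] [InnerProductSpace 𝕜 H]
    (R S : H →ₗ.[𝕜] H) : H →ₗ.[𝕜] H :=
  R.comp (S.domRestrict (compDomain R S)) (by
    rintro ⟨x, hx⟩
    have h1 : x ∈ compDomain R S := hx.1
    obtain ⟨h, hR⟩ := (mem_compDomain R S x).1 h1
    have h2 : S.domRestrict (compDomain R S) ⟨x, hx⟩ = S ⟨x, h⟩ :=
      LinearPMap.domRestrict_apply rfl
    rw [h2]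
    exact hR)

theorem mem_comp_domain {𝕜 H : Type*} [RCLike 𝕜] [NormedAddCommGroup H] [InnerProductSpace 𝕜 H]
    (R S : H →ₗ.[𝕜] H) (x : H) :
    x ∈ (comp R S).domain ↔ ∃ h : x ∈ S.domain, S ⟨x, h⟩ ∈ R.domain := by
  rw [← mem_compDomain]
  constructor
  · intro h
    exact h.1
  · intro h
    exact ⟨h, ((mem_compDomain R S x).1 h).1⟩

theorem comp_apply {𝕜 H : Type*} [RCLike 𝕜] [NormedAddCommGroup H] [InnerProductSpace 𝕜 H]
    (R S : H →ₗ.[𝕜] H) (x : H) (hx : x ∈ (comp R S).domain) (h : x ∈ S.domain)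
    (h' : S ⟨x, h⟩ ∈ R.domain) :
    comp R S ⟨x, hx⟩ = R ⟨S ⟨x, h⟩, h'⟩ := rfl

/-- A measurable functional calculus on the measurable space `X` with Hilbert space `H`: a map
from the measurable scalar functions on `X` to the closed operators in `H`.
The order `≤` on partial operators is inclusion of graphs, and the sum of two partial operators
is defined on the intersection of their domains. -/
structure MeasurableCalculus (𝕜 : Type*) [RCLike 𝕜] [MeasurableSpace 𝕜] [BorelSpace 𝕜]
    (X : Type*) [MeasurableSpace X] (H : Type*) [NormedAddCommGroup H] [InnerProductSpace 𝕜 H] [CompleteSpace H] where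
  /-- the map `Φ` -/
  toFun : MeasurableFunctions 𝕜 X → (H →ₗ.[𝕜] H)
  isClosed : ∀ f, (toFun f).IsClosed
  map_one : toFun 1 = ofBounded (ContinuousLinearMap.id 𝕜 H)
  add_le : ∀ f g, toFun f + toFun g ≤ toFun (f + g)
  smul_le : ∀ (c : 𝕜) f, c • toFun f ≤ toFun (c • f)
  comp_le : ∀ f g, comp (toFun f) (toFun g) ≤ toFun (f * g)
  domain_comp : ∀ f g,
    (comp (toFun f) (toFun g)).domain = (toFun g).domain ⊓ (toFun (f * g)).domain
  /-- If `f` is bounded, then `Φ(f)` is a bounded operator, and its adjoint is the image of the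
  conjugate of `f`. -/
  bounded : ∀ f : MeasurableFunctions 𝕜 X, (∃ C : ℝ, ∀ x, ‖f.1 x‖ ≤ C) →
    ∃ T : H →L[𝕜] H, toFun f = ofBounded T ∧
      toFun (star f) = ofBounded (ContinuousLinearMap.adjoint T)
  /-- If `f n → g` pointwise and boundedly, then the (bounded) operators `Φ(f n)` converge to
  `Φ(g)` in the weak operator topology. -/
  weak_bp_continuous : ∀ (f : ℕ → MeasurableFunctions 𝕜 X) (g : MeasurableFunctions 𝕜 X),
    (∃ C : ℝ, ∀ n x, ‖(f n).1 x‖ ≤ C) →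
    (∀ x, Tendsto (fun n => (f n).1 x) atTop (𝓝 (g.1 x))) →
    ∀ (T : ℕ → H →L[𝕜] H) (S : H →L[𝕜] H),
      (∀ n, toFun (f n) = ofBounded (T n)) → toFun g = ofBounded S →
      ∀ x y : H, Tendsto (fun n => inner 𝕜 y (T n x)) atTop (𝓝 (inner 𝕜 y (S x)))

/-- A Borel calculus is a measurable functional calculus on a topological space with its Borel
σ-algebra. -/
abbrev BorelCalculus (𝕜 : Type*) [RCLike 𝕜] [MeasurableSpace 𝕜] [BorelSpace 𝕜]
    (X : Type*) [TopologicalSpace X] [MeasurableSpace X] [BorelSpace X] (H : Type*) [NormedAddCommGroup H] [InnerProductSpace 𝕜 H]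
    [CompleteSpace H] :=
  MeasurableCalculus 𝕜 X H

/-- The coordinate function `z_j` on `𝕜^d`. -/
def coord (𝕜 : Type*) [RCLike 𝕜] [MeasurableSpace 𝕜] [BorelSpace 𝕜] {d : ℕ} (j : Fin d) :
    MeasurableFunctions 𝕜 (Fin d → 𝕜) :=
  ⟨fun z => z j, show Measurable (fun z : Fin d → 𝕜 => z j) from measurable_pi_apply j⟩

end SpectralCalculus

/-! Existence rests on positivity. Let π be the algebra homomorphism from polynomials to operators
with X_j ↦ A_j, and let R > 0 with ‖A_j‖ ≤ R for all j. If p ≥ 0 on [-R, R]^d, then ⟨π(p)x, x⟩ ≥ 0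
(`polynomial_isPositive`). After rescaling to the unit cube this combines two facts: products of
commuting positive operators are positive (`isPositive_mul`), and Bernstein expansion writes p, up
to a small error, as a nonnegative combination of products of powers of c_j and 1 - c_j
(`aeval_nonneg_of_nonneg_on_cube`). The M. Riesz extension theorem and Riesz-Markov-Kakutani then
give a finite measure μ_x on the cube with ∫ p dμ_x = ⟨π(p)x, x⟩ (`exists_moment_measure`).

Since ‖π(p)x‖² = ∫ p² dμ_x and polynomials are dense in L²(μ_x), the map p ↦ π(p)x extends by
continuity; this defines Ψ(f)x for every measurable f bounded on the cube, and the algebraic laws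
survive the limit (`exists_isBoxCalculus`). For arbitrary f, y = Φ(f)x is declared to mean Ψ(e)y =
Ψ(ef)x, where e > 0 and both e and ef are bounded on the cube. Injectivity of Ψ(e) makes this
relation a closed graph independent of e.

For uniqueness, any calculus with Φ(z_j) = A_j kills the indicator of {|z_j| > R} once R > ‖A_j‖
(`map_indicator_eq_zero`), so it lives on the cube. There the coordinates generate all bounded
functions under sums, products and bounded limits (`borel_induction`), which determines Φ on bounded
functions; the domain law for products then determines the graph of Φ(f) for every f
(`mem_graph_iff`). -/

open MeasureTheory
open scoped InnerProductSpace

namespace SpectralCalculus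

/-! ### Products of commuting positive operators -/

section CommutingPositive

variable {H : Type*} [NormedAddCommGroup H] [InnerProductSpace ℝ H]

/-- The iteration `s ↦ s - s²`. -/
def subSqIter (S : H →L[ℝ] H) : ℕ → H →L[ℝ] H
  | 0 => S
  | n + 1 => subSqIter S n - subSqIter S n * subSqIter S n

theorem subSqIter_commute {S T : H →L[ℝ] H} (h : Commute T S) (n : ℕ) :
    Commute T (subSqIter S n) := by
  induction n with
  | zero => exact h
  | succ n ih => exact ih.sub_right (ih.mul_right ih)

theorem sum_sq_subSqIter (S : H →L[ℝ] H) (n : ℕ) :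
    ∑ k ∈ Finset.range n, subSqIter S k * subSqIter S k = S - subSqIter S n := by
  induction n with
  | zero => simp [subSqIter]
  | succ n ih => rw [Finset.sum_range_succ, ih, subSqIter]; abel

variable [CompleteSpace H]

theorem isPositive_conj {T S : H →L[ℝ] H} (hT : T.IsPositive) (hS : IsSelfAdjoint S) :
    (S * T * S).IsPositive := by
  have h := hT.conj_adjoint S
  rw [hS.adjoint_eq] at h
  simpa [ContinuousLinearMap.mul_def, ContinuousLinearMap.comp_assoc] using h

theorem subSqIter_isPositive {S : H →L[ℝ] H} (h0 : S.IsPositive) (h1 : (1 - S).IsPositive)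
    (n : ℕ) : (subSqIter S n).IsPositive ∧ (1 - subSqIter S n).IsPositive := by
  induction n with
  | zero => exact ⟨h0, h1⟩
  | succ n ih =>
    obtain ⟨hp, hq⟩ := ih
    set s := subSqIter S n
    -- Both identities exhibit s - s² and 1 - (s - s²) as sums of positive operators, using only
    -- conjugation by self-adjoint ones.
    have e1 : subSqIter S (n + 1) = s * (1 - s) * s + (1 - s) * s * (1 - s) := by
      simp only [subSqIter]; noncomm_ring
    have e2 : 1 - subSqIter S (n + 1) = (1 - s) + s * 1 * s := by
      simp only [subSqIter]; noncomm_ring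
    rw [e2, e1]
    exact ⟨(isPositive_conj hq hp.isSelfAdjoint).add (isPositive_conj hp hq.isSelfAdjoint),
      hq.add (isPositive_conj ContinuousLinearMap.isPositive_one hp.isSelfAdjoint)⟩

theorem inner_sq_apply {S : H →L[ℝ] H} (hS : IsSelfAdjoint S) (x : H) :
    ⟪(S * S) x, x⟫_ℝ = ‖S x‖ ^ 2 := by
  rw [mul_apply_eq_comp, ← ContinuousLinearMap.adjoint_inner_right, hS.adjoint_eq,
    real_inner_self_eq_norm_sq]

/-- The squares telescope: Σ_{k<n} ‖s_k x‖² = ⟨Sx, x⟩ - ⟨s_n x, x⟩ ≤ ⟨Sx, x⟩, so the series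
converges and its terms tend to zero. -/
theorem tendsto_subSqIter {S : H →L[ℝ] H} (h0 : S.IsPositive) (h1 : (1 - S).IsPositive) (x : H) :
    Tendsto (fun n => subSqIter S n x) atTop (𝓝 0) := by
  have hsum : Summable fun n => ‖subSqIter S n x‖ ^ 2 := by
    refine summable_of_sum_range_le (c := ⟪S x, x⟫_ℝ) (fun n => by positivity) fun n => ?_
    have := congrArg (fun T : H →L[ℝ] H => ⟪T x, x⟫_ℝ) (sum_sq_subSqIter S n)
    simp only [sum_apply, sum_inner, sub_apply,
      inner_sub_left] at this
    simp_rw [inner_sq_apply (subSqIter_isPositive h0 h1 _).1.isSelfAdjoint] at this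
    have h := (subSqIter_isPositive h0 h1 n).1.inner_nonneg_left x
    linarith
  have := hsum.tendsto_atTop_zero
  rw [tendsto_zero_iff_norm_tendsto_zero]
  have h2 := this.sqrt
  simpa using h2

/-- Telescoping gives S = s_n + Σ s_k², and commutation turns T s_k² into s_k T s_k, which is
positive. Hence ⟨TSx, x⟩ ≥ ⟨T s_n x, x⟩, and the right side tends to 0. -/
theorem isPositive_mul_of_le_one {T S : H →L[ℝ] H} (hT : T.IsPositive) (h0 : S.IsPositive)
    (h1 : (1 - S).IsPositive) (h : Commute T S) : (T * S).IsPositive := by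
  rw [ContinuousLinearMap.isPositive_iff]
  refine ⟨(hT.isSelfAdjoint.commute_iff h0.isSelfAdjoint).1 h |>.isSymmetric, fun x => ?_⟩
  have key : ∀ n, ⟪T (subSqIter S n x), x⟫_ℝ ≤ ⟪(T * S) x, x⟫_ℝ := by
    intro n
    have e : T * S = T * subSqIter S n +
        ∑ k ∈ Finset.range n, subSqIter S k * T * subSqIter S k := by
      have : ∀ k, subSqIter S k * T * subSqIter S k = T * (subSqIter S k * subSqIter S k) :=
        fun k => by rw [← (subSqIter_commute h k).eq, mul_assoc]
      simp_rw [this]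
      rw [← Finset.mul_sum, sum_sq_subSqIter, ← mul_add]
      simp
    have := congrArg (fun T : H →L[ℝ] H => ⟪T x, x⟫_ℝ) e
    simp only [add_apply, sum_apply, sum_inner,
      inner_add_left] at this
    rw [this]
    have h3 : 0 ≤ ∑ k ∈ Finset.range n, ⟪(subSqIter S k * T * subSqIter S k) x, x⟫_ℝ :=
      Finset.sum_nonneg fun k _ => (isPositive_conj hT
        (subSqIter_isPositive h0 h1 k).1.isSelfAdjoint).inner_nonneg_left x
    simpa using h3
  refine le_of_tendsto' (f := fun n => ⟪T (subSqIter S n x), x⟫_ℝ) (x := atTop) ?_ key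
  have := ((T.continuous.tendsto 0).comp (tendsto_subSqIter h0 h1 x)).inner (𝕜 := ℝ)
    (tendsto_const_nhds (x := x))
  simpa using this

theorem isPositive_mul {T S : H →L[ℝ] H} (hT : T.IsPositive) (hS : S.IsPositive)
    (h : Commute T S) : (T * S).IsPositive := by
  set c : ℝ := ‖S‖ + 1
  have hc : 0 < c := by positivity
  have h0 : (c⁻¹ • S).IsPositive := hS.smul_of_nonneg (by positivity)
  have h1 : (1 - c⁻¹ • S).IsPositive := by
    rw [ContinuousLinearMap.isPositive_iff]
    refine ⟨((IsSelfAdjoint.one _).sub h0.isSelfAdjoint).isSymmetric, fun x => ?_⟩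
    have h2 : ⟪S x, x⟫_ℝ ≤ ‖S‖ * ‖x‖ * ‖x‖ := (real_inner_le_norm _ _).trans
      (by gcongr; exact S.le_opNorm x)
    have h3 : c⁻¹ * ⟪S x, x⟫_ℝ ≤ ‖x‖ ^ 2 := by
      rw [inv_mul_le_iff₀ hc]; nlinarith [sq_nonneg ‖x‖]
    simp [inner_sub_left, inner_smul_left]
    linarith
  have h2 := isPositive_mul_of_le_one hT h0 h1 (h.smul_right _)
  have : T * S = c • (T * (c⁻¹ • S)) := by
    rw [mul_smul_comm, smul_smul, mul_inv_cancel₀ hc.ne', one_smul]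
  rw [this]
  exact h2.smul_of_nonneg hc.le

end CommutingPositive

/-! ### Bernstein approximation and positivity on the cube -/

section Bernstein

/-- The Bernstein weights expand a power: `x ^ a = ∑ (k)_a / (n)_a * b_{n,k}(x)`. -/
theorem pow_eq_sum_bernstein {B : Type*} [CommRing B] [Algebra ℝ B] (x : B) {a n : ℕ}
    (h : a ≤ n) :
    x ^ a = ∑ k ∈ Finset.range (n + 1),
      (((k.descFactorial a : ℝ) / n.descFactorial a) * n.choose k) •
        (x ^ k * (1 - x) ^ (n - k)) := by
  have hn : (n.descFactorial a : ℝ) ≠ 0 := by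
    exact_mod_cast (Nat.descFactorial_pos.2 h).ne'
  obtain ⟨m, rfl⟩ := Nat.exists_eq_add_of_le h
  have e : a + m + 1 = a + (m + 1) := by ring
  rw [e, Finset.sum_range_add, Finset.sum_eq_zero, zero_add]
  -- With m = n - a, multiply by 1 = (x + (1 - x))^m and expand; the ratio of falling factorials
  -- times C(n, a + k) is C(m, k). The terms of index below a vanish because their falling factorial
  -- does.
  · have h1 : x ^ a = x ^ a * (x + (1 - x)) ^ m := by simp
    conv_lhs => rw [h1, add_pow, Finset.mul_sum]
    refine Finset.sum_congr rfl fun k hk => ?_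
    have hk' : k ≤ m := by simpa [Nat.lt_succ_iff] using hk
    have hc : ((a + k).descFactorial a : ℝ) / (a + m).descFactorial a * (a + m).choose (a + k)
        = m.choose k := by
      rw [div_mul_eq_mul_div, div_eq_iff hn]
      have := Nat.choose_mul (n := a + m) (k := a + k) (s := a) (by omega)
      have h2 := Nat.descFactorial_eq_factorial_mul_choose (a + k) a
      have h3 := Nat.descFactorial_eq_factorial_mul_choose (a + m) a
      rw [h2, h3]
      simp only [Nat.add_sub_cancel_left] at this
      have h4 : (((a + m).choose (a + k) : ℝ) * (a + k).choose a)
        = (a + m).choose a * m.choose k := by exact_mod_cast this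
      push_cast
      linear_combination (a.factorial : ℝ) * h4
    rw [hc, Nat.add_sub_add_left, Algebra.smul_def, map_natCast]
    ring
  · intro k hk
    rw [Nat.descFactorial_of_lt (Finset.mem_range.1 hk)]
    simp

theorem descFactorial_div_mem_Icc {k n : ℕ} (h : k ≤ n) (a : ℕ) :
    (k.descFactorial a : ℝ) / n.descFactorial a ∈ Set.Icc (0 : ℝ) 1 :=
  ⟨by positivity, div_le_one_of_le₀ (by exact_mod_cast Nat.descFactorial_le a h) (by positivity)⟩

theorem cast_div_mem_Icc {k n : ℕ} (h : k ≤ n) : (k : ℝ) / n ∈ Set.Icc (0 : ℝ) 1 :=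
  ⟨by positivity, div_le_one_of_le₀ (by exact_mod_cast h) (by positivity)⟩

theorem abs_mul_sub_mul_le {a b c d : ℝ} (ha : a ∈ Set.Icc (0 : ℝ) 1) (hd : d ∈ Set.Icc (0 : ℝ) 1) :
    |a * b - c * d| ≤ |a - c| + |b - d| := by
  have : a * b - c * d = a * (b - d) + d * (a - c) := by ring
  rw [this]
  refine (abs_add_le _ _).trans ?_
  rw [abs_mul, abs_mul, abs_of_nonneg ha.1, abs_of_nonneg hd.1]
  nlinarith [mul_le_mul_of_nonneg_right ha.2 (abs_nonneg (b - d)),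
    mul_le_mul_of_nonneg_right hd.2 (abs_nonneg (a - c))]

/-- Each new factor is (k - a)/(n - a), which differs from k/n by at most a/(n - a), uniformly in k
≤ n. Since all quantities lie in [0, 1], the errors of the factors add. -/
theorem tendstoUniformly_descFactorial_div (a : ℕ) {ε : ℝ} (hε : 0 < ε) :
    ∀ᶠ n : ℕ in atTop, ∀ k ≤ n,
      |(k.descFactorial a : ℝ) / n.descFactorial a - ((k : ℝ) / n) ^ a| ≤ ε := by
  induction a generalizing ε with
  | zero => simp [hε.le]
  | succ a ih =>
    have h1 : ∀ᶠ n : ℕ in atTop, (a : ℝ) / ((n : ℝ) - a) ≤ ε / 2 := by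
      have : Tendsto (fun n : ℕ => (a : ℝ) / ((n : ℝ) - a)) atTop (𝓝 0) := by
        refine Tendsto.div_atTop tendsto_const_nhds ?_
        exact tendsto_atTop_add_const_right _ (-(a : ℝ)) tendsto_natCast_atTop_atTop
      exact (this.eventually (gt_mem_nhds (half_pos hε))).mono fun _ h => le_of_lt h
    filter_upwards [ih (half_pos hε), h1, eventually_gt_atTop a] with n hn h1 han k hk
    have hna : (0 : ℝ) < (n : ℝ) - a := by
      have : (a : ℝ) < n := by exact_mod_cast han
      linarith
    have hn0 : (0 : ℝ) < n := by linarith [(Nat.cast_nonneg a : (0 : ℝ) ≤ a)]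
    have e : (k.descFactorial (a + 1) : ℝ) / n.descFactorial (a + 1)
        = ((k - a : ℕ) : ℝ) / (n - a : ℕ) * ((k.descFactorial a : ℝ) / n.descFactorial a) := by
      rw [Nat.descFactorial_succ, Nat.descFactorial_succ]
      push_cast
      rw [mul_div_mul_comm]
    rw [e, pow_succ']
    have h2 : |((k - a : ℕ) : ℝ) / (n - a : ℕ) - (k : ℝ) / n| ≤ ε / 2 := by
      refine le_trans ?_ h1
      rw [Nat.cast_sub han.le]
      -- For k < a the truncated difference k - a is 0, and k/n itself is the error.
      rcases le_or_gt a k with hak | hak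
      · rw [Nat.cast_sub hak]
        have e2 : ((k : ℝ) - a) / ((n : ℝ) - a) - k / n = -(a / (n - a) * (1 - k / n)) := by
          field_simp
          ring
        rw [e2, abs_neg, abs_mul, abs_of_nonneg (by positivity : (0 : ℝ) ≤ a / (n - a))]
        refine mul_le_of_le_one_right (by positivity) ?_
        have := cast_div_mem_Icc hk
        rw [abs_le]
        constructor <;> linarith [this.1, this.2]
      · rw [Nat.sub_eq_zero_of_le hak.le]
        simp only [Nat.cast_zero, zero_div, zero_sub, abs_neg]
        rw [abs_of_nonneg (by positivity)]
        have : (k : ℝ) ≤ a := by exact_mod_cast hak.le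
        exact div_le_div₀ (by positivity) this hna (by linarith [(Nat.cast_nonneg a : (0 : ℝ) ≤ a)])
    have hp : ((k : ℝ) / n) ^ a ∈ Set.Icc (0 : ℝ) 1 :=
      ⟨pow_nonneg (cast_div_mem_Icc hk).1 _,
        pow_le_one₀ (cast_div_mem_Icc hk).1 (cast_div_mem_Icc hk).2⟩
    refine (abs_mul_sub_mul_le ?_ hp).trans ?_
    · exact cast_div_mem_Icc (Nat.sub_le_sub_right hk a)
    · linarith [hn k hk]

theorem abs_prod_sub_prod_le {ι : Type*} (s : Finset ι) (u v : ι → ℝ)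
    (hu : ∀ i ∈ s, u i ∈ Set.Icc (0 : ℝ) 1) (hv : ∀ i ∈ s, v i ∈ Set.Icc (0 : ℝ) 1) :
    |∏ i ∈ s, u i - ∏ i ∈ s, v i| ≤ ∑ i ∈ s, |u i - v i| := by
  classical
  induction s using Finset.induction_on with
  | empty => simp
  | insert i s hi ih =>
    rw [Finset.prod_insert hi, Finset.prod_insert hi, Finset.sum_insert hi]
    refine (abs_mul_sub_mul_le (hu i (by simp)) ⟨?_, ?_⟩).trans ?_
    · exact Finset.prod_nonneg fun j hj => (hv j (by simp [hj])).1
    · exact Finset.prod_le_one (fun j hj => (hv j (by simp [hj])).1)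
        fun j hj => (hv j (by simp [hj])).2
    · gcongr
      exact ih (fun j hj => hu j (by simp [hj])) fun j hj => hv j (by simp [hj])

/-- A linear functional that is nonnegative on the products `∏ c_j ^ a_j (1 - c_j) ^ b_j` is
nonnegative on the polynomials in `c` that are nonnegative on the unit cube. -/
theorem aeval_nonneg_of_nonneg_on_cube {d : ℕ} {B : Type*} [CommRing B] [Algebra ℝ B]
    (c : Fin d → B) (L : B →ₗ[ℝ] ℝ)
    (hL : ∀ a b : Fin d → ℕ, 0 ≤ L (∏ j, (c j ^ a j * (1 - c j) ^ b j)))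
    (p : MvPolynomial (Fin d) ℝ)
    (hp : ∀ t : Fin d → ℝ, (∀ j, t j ∈ Set.Icc (0 : ℝ) 1) → 0 ≤ MvPolynomial.eval t p) :
    0 ≤ L (MvPolynomial.aeval c p) := by
  classical
  set W : ℕ → (Fin d → ℕ) → B := fun n k =>
    ∏ j, ((n.choose (k j) : ℝ) • (c j ^ k j * (1 - c j) ^ (n - k j))) with hW
  set G : ℕ → Finset (Fin d → ℕ) := fun n => Fintype.piFinset fun _ => Finset.range (n + 1)
  set D : ℕ → (Fin d →₀ ℕ) → (Fin d → ℕ) → ℝ := fun n a k =>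
    ∏ j, ((k j).descFactorial (a j) : ℝ) / n.descFactorial (a j)
  have hGle : ∀ {n k}, k ∈ G n → ∀ j, k j ≤ n := fun {n k} hk j => by
    have := Fintype.mem_piFinset.1 hk j
    simpa [Nat.lt_succ_iff] using this
  have hWnn : ∀ n k, 0 ≤ L (W n k) := by
    intro n k
    have : W n k = (∏ j, (n.choose (k j) : ℝ)) • ∏ j, (c j ^ k j * (1 - c j) ^ (n - k j)) := by
      rw [hW]; simp only [Algebra.smul_def, Finset.prod_mul_distrib, map_prod]
    rw [this, map_smul]
    exact mul_nonneg (Finset.prod_nonneg fun _ _ => by positivity) (hL _ _)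
  have hmono : ∀ (n : ℕ) (a : Fin d →₀ ℕ), (∀ j, a j ≤ n) →
      ∏ j, c j ^ a j = ∑ k ∈ G n, D n a k • W n k := by
    intro n a ha
    simp_rw [fun j => pow_eq_sum_bernstein (c j) (ha j)]
    rw [Finset.prod_univ_sum]
    refine Finset.sum_congr rfl fun k _ => ?_
    simp only [D, hW, Algebra.smul_def, map_prod, map_mul]
    rw [← Finset.prod_mul_distrib]
    exact Finset.prod_congr rfl fun j _ => by ring
  have hWsum : ∀ n, ∑ k ∈ G n, L (W n k) = L 1 := by
    intro n
    have := hmono n 0 (by simp)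
    simp [D] at this
    rw [this, map_sum]
  have hL1 : 0 ≤ L 1 := by simpa using hL 0 0
  refine le_of_forall_pos_le_add fun ε hε => ?_
  -- Each Bernstein coefficient of p differs from p(k/n) ≥ 0 by at most Σ |coeff| · d times the
  -- error per factor, and the weights have total mass L 1. The added 1 keeps the divisor positive.
  set C : ℝ := (∑ a ∈ p.support, |p.coeff a| * d) * L 1 + 1
  have hC : 0 < C := by positivity
  have hev : ∀ᶠ n : ℕ in atTop, ∀ a ∈ p.support, ∀ j : Fin d, ∀ k ≤ n,
      |(k.descFactorial (a j) : ℝ) / n.descFactorial (a j) - ((k : ℝ) / n) ^ a j| ≤ ε / C := by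
    rw [Filter.eventually_all_finset]
    intro a _
    rw [Filter.eventually_all]
    exact fun j => tendstoUniformly_descFactorial_div (a j) (div_pos hε hC)
  have hev2 : ∀ᶠ n : ℕ in atTop, ∀ a ∈ p.support, ∀ j : Fin d, a j ≤ n := by
    rw [Filter.eventually_all_finset]
    intro a _
    rw [Filter.eventually_all]
    exact fun j => eventually_ge_atTop _
  obtain ⟨n, hn1, hn2⟩ := (hev.and hev2).exists
  have e1 : MvPolynomial.aeval c p
      = ∑ k ∈ G n, (∑ a ∈ p.support, p.coeff a * D n a k) • W n k := by
    rw [MvPolynomial.aeval_def, MvPolynomial.eval₂_eq']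
    simp_rw [Finset.sum_smul]
    rw [Finset.sum_comm]
    refine Finset.sum_congr rfl fun a ha => ?_
    rw [hmono n a (hn2 a ha), ← Algebra.smul_def, Finset.smul_sum]
    simp_rw [smul_smul]
  have h2 : ∀ k ∈ G n, -((∑ a ∈ p.support, |p.coeff a| * d) * (ε / C)) ≤
      ∑ a ∈ p.support, p.coeff a * D n a k := by
    intro k hk
    have h3 := hp (fun j => (k j : ℝ) / n) fun j => cast_div_mem_Icc (hGle hk j)
    rw [MvPolynomial.eval_eq'] at h3
    have h4 : |∑ a ∈ p.support, p.coeff a * D n a k -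
        ∑ a ∈ p.support, p.coeff a * ∏ j, ((k j : ℝ) / n) ^ a j| ≤
        (∑ a ∈ p.support, |p.coeff a| * d) * (ε / C) := by
      rw [← Finset.sum_sub_distrib, Finset.sum_mul]
      refine (Finset.abs_sum_le_sum_abs _ _).trans (Finset.sum_le_sum fun a ha => ?_)
      rw [← mul_sub, abs_mul, mul_assoc]
      gcongr
      refine (abs_prod_sub_prod_le _ _ _ (fun j _ => descFactorial_div_mem_Icc (hGle hk j) _)
        fun j _ => ⟨pow_nonneg (cast_div_mem_Icc (hGle hk j)).1 _,
          pow_le_one₀ (cast_div_mem_Icc (hGle hk j)).1 (cast_div_mem_Icc (hGle hk j)).2⟩).trans ?_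
      refine (Finset.sum_le_card_nsmul _ _ _ fun j _ => hn1 a ha j (k j) (hGle hk j)).trans ?_
      simp
    linarith [(abs_le.1 h4).1]
  have h5 : -((∑ a ∈ p.support, |p.coeff a| * d) * (ε / C)) * L 1 ≤ L (MvPolynomial.aeval c p) := by
    rw [e1, map_sum, ← hWsum n, Finset.mul_sum]
    refine Finset.sum_le_sum fun k hk => ?_
    rw [map_smul, smul_eq_mul]
    exact mul_le_mul_of_nonneg_right (h2 k hk) (hWnn n k)
  have h6 : (∑ a ∈ p.support, |p.coeff a| * d) * (ε / C) * L 1 ≤ ε := by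
    have : (∑ a ∈ p.support, |p.coeff a| * d) * (ε / C) * L 1 =
      ((∑ a ∈ p.support, |p.coeff a| * d) * L 1) * ε / C := by ring
    rw [this, div_le_iff₀ hC, mul_comm]
    gcongr
    simp [C]
  linarith

end Bernstein

/-! ### The cube carrying the calculus -/

section Box

/-- The cube `[-R, R]^d`. -/
def box (d : ℕ) (R : ℝ) : Set (Fin d → ℝ) := {z | ∀ j, |z j| ≤ R}

theorem box_eq_pi (d : ℕ) (R : ℝ) : box d R = Set.univ.pi fun _ => Set.Icc (-R) R := by
  ext z; simp only [box, abs_le, Set.mem_ofPred_eq, Set.mem_univ_pi, Set.mem_Icc]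

theorem isCompact_box (d : ℕ) (R : ℝ) : IsCompact (box d R) := by
  rw [box_eq_pi]; exact isCompact_univ_pi fun _ => isCompact_Icc

theorem measurableSet_box (d : ℕ) (R : ℝ) : MeasurableSet (box d R) :=
  (isCompact_box d R).measurableSet

end Box

/-! ### Polynomial calculus and representing measures -/

section Moments

variable {H : Type*} [NormedAddCommGroup H] [InnerProductSpace ℝ H] {d : ℕ}

open scoped IsMulCommutative in
theorem exists_polynomial_calculus (A : Fin d → (H →L[ℝ] H))
    (hcomm : ∀ i j, A i ∘L A j = A j ∘L A i) :
    ∃ π : MvPolynomial (Fin d) ℝ →ₐ[ℝ] (H →L[ℝ] H), ∀ j, π (MvPolynomial.X j) = A j := by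
  have hc : ∀ a ∈ Set.range A, ∀ b ∈ Set.range A, a * b = b * a := by
    rintro _ ⟨i, rfl⟩ _ ⟨j, rfl⟩
    exact hcomm i j
  have := Algebra.isMulCommutative_adjoin ℝ hc
  -- Evaluation of polynomials needs a commutative target, so it passes through the commutative
  -- algebra generated by the A_j.
  refine ⟨(Algebra.adjoin ℝ (Set.range A)).val.comp (MvPolynomial.aeval fun j =>
    (⟨A j, Algebra.subset_adjoin ⟨j, rfl⟩⟩ : Algebra.adjoin ℝ (Set.range A))), fun j => ?_⟩
  simp

variable (π : MvPolynomial (Fin d) ℝ →ₐ[ℝ] (H →L[ℝ] H))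

theorem polynomial_commute (p q : MvPolynomial (Fin d) ℝ) : Commute (π p) (π q) := by
  rw [Commute, SemiconjBy, ← map_mul, mul_comm, map_mul]

variable [CompleteSpace H]

theorem polynomial_isSelfAdjoint (hsa : ∀ j, IsSelfAdjoint (π (MvPolynomial.X j)))
    (p : MvPolynomial (Fin d) ℝ) : IsSelfAdjoint (π p) := by
  induction p using MvPolynomial.induction_on with
  | C a =>
    have : π (MvPolynomial.C a) = a • 1 := by
      rw [← MvPolynomial.algebraMap_eq, AlgHom.commutes, Algebra.algebraMap_eq_smul_one]
    rw [this]
    exact (IsSelfAdjoint.all a).smul (IsSelfAdjoint.one _)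
  | add p q hp hq => rw [map_add]; exact hp.add hq
  | mul_X p j hp =>
    rw [map_mul]
    exact (hp.commute_iff (hsa j)).1 (polynomial_commute π _ _)

/-- The substitution c_j = (X_j + R)/(2R) carries [-R, R]^d to the unit cube, and ‖A_j‖ ≤ R makes
π(c_j) and π(1 - c_j) positive. Products of these commuting operators stay positive, so the
Bernstein criterion applies to p after the inverse substitution g. -/
theorem polynomial_isPositive (hsa : ∀ j, IsSelfAdjoint (π (MvPolynomial.X j))) {R : ℝ}
    (hR : 0 < R) (hA : ∀ j, ‖π (MvPolynomial.X j)‖ ≤ R) (p : MvPolynomial (Fin d) ℝ)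
    (hp : ∀ z ∈ box d R, 0 ≤ MvPolynomial.eval z p) (x : H) : 0 ≤ ⟪π p x, x⟫_ℝ := by
  set c : Fin d → MvPolynomial (Fin d) ℝ := fun j =>
    MvPolynomial.C (2 * R)⁻¹ * (MvPolynomial.X j + MvPolynomial.C R) with hc
  set g : Fin d → MvPolynomial (Fin d) ℝ := fun j =>
    MvPolynomial.C (2 * R) * MvPolynomial.X j - MvPolynomial.C R with hg
  have hC : ∀ a : ℝ, π (MvPolynomial.C a) = a • 1 := fun a => by
    rw [← MvPolynomial.algebraMap_eq, AlgHom.commutes, Algebra.algebraMap_eq_smul_one]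
  have hcg : ∀ q, MvPolynomial.aeval c (MvPolynomial.aeval g q) = q := by
    intro q
    have : (MvPolynomial.aeval c).comp (MvPolynomial.aeval g) = AlgHom.id ℝ _ := by
      refine MvPolynomial.algHom_ext fun j => ?_
      simp only [hg, hc, AlgHom.comp_apply, MvPolynomial.aeval_X, map_sub, map_mul,
        MvPolynomial.aeval_C, MvPolynomial.algebraMap_eq, AlgHom.id_apply]
      have h1 : (MvPolynomial.C (2 * R) * MvPolynomial.C (2 * R)⁻¹ : MvPolynomial (Fin d) ℝ) = 1 := by
        rw [← MvPolynomial.C_mul, mul_inv_cancel₀ (mul_pos two_pos hR).ne', MvPolynomial.C_1]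
      rw [MvPolynomial.C_mul] at h1
      rw [← mul_assoc, h1]
      simp
    exact congrArg (fun f => f q) this
  have hbound : ∀ j, ∀ y, |⟪π (MvPolynomial.X j) y, y⟫_ℝ| ≤ R * ‖y‖ ^ 2 := fun j y => by
    refine (abs_real_inner_le_norm _ _).trans ?_
    rw [pow_two, ← mul_assoc]
    gcongr
    exact (π (MvPolynomial.X j)).le_of_opNorm_le (hA j) y
  have hc_apply : ∀ j, π (c j) = (2 * R)⁻¹ • (π (MvPolynomial.X j) + R • 1) := fun j => by
    simp only [hc, map_mul, map_add, hC, smul_mul_assoc, one_mul]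
  have hc1_apply : ∀ j, π (1 - c j) = (2 * R)⁻¹ • (R • 1 - π (MvPolynomial.X j)) := fun j => by
    have : (1 : H →L[ℝ] H) = (2 * R)⁻¹ • ((R + R) • 1) := by
      rw [smul_smul, ← two_mul, inv_mul_cancel₀ (by positivity), one_smul]
    rw [map_sub, hc_apply, map_one]
    nth_rw 1 [this]
    rw [← smul_sub, add_smul]
    congr 1
    abel
  have hpos : ∀ j, (π (c j)).IsPositive := fun j => by
    rw [ContinuousLinearMap.isPositive_iff]
    refine ⟨(polynomial_isSelfAdjoint π hsa _).isSymmetric, fun y => ?_⟩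
    rw [hc_apply]
    simp only [_root_.smul_apply, _root_.add_apply, inner_smul_left, inner_add_left,
      one_apply_eq_self, real_inner_self_eq_norm_sq]
    exact mul_nonneg (by simp; positivity) (by simpa using by linarith [(abs_le.1 (hbound j y)).1])
  have hpos1 : ∀ j, (π (1 - c j)).IsPositive := fun j => by
    rw [ContinuousLinearMap.isPositive_iff]
    refine ⟨(polynomial_isSelfAdjoint π hsa _).isSymmetric, fun y => ?_⟩
    rw [hc1_apply]
    simp only [_root_.smul_apply, _root_.sub_apply, inner_smul_left, inner_sub_left,
      one_apply_eq_self, real_inner_self_eq_norm_sq]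
    exact mul_nonneg (by simp; positivity) (by simpa using by linarith [(abs_le.1 (hbound j y)).2])
  have hmul : ∀ q r : MvPolynomial (Fin d) ℝ, (π q).IsPositive → (π r).IsPositive →
      (π (q * r)).IsPositive := fun q r hq hr => by
    rw [map_mul]; exact isPositive_mul hq hr (polynomial_commute π q r)
  have hone : (π 1).IsPositive := by rw [map_one]; exact ContinuousLinearMap.isPositive_one
  have hpow : ∀ (q : MvPolynomial (Fin d) ℝ), (π q).IsPositive → ∀ n : ℕ, (π (q ^ n)).IsPositive := by
    intro q hq n
    induction n with
    | zero => rwa [pow_zero]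
    | succ n ih => rw [pow_succ]; exact hmul _ _ ih hq
  let L : MvPolynomial (Fin d) ℝ →ₗ[ℝ] ℝ :=
    { toFun := fun q => ⟪π q x, x⟫_ℝ
      map_add' := fun q r => by simp [inner_add_left]
      map_smul' := fun a q => by simp [inner_smul_left] }
  have key := aeval_nonneg_of_nonneg_on_cube c L (fun a b =>
    (Finset.prod_induction _ (fun q => (π q).IsPositive) hmul hone fun j _ =>
      hmul _ _ (hpow _ (hpos j) _) (hpow _ (hpos1 j) _)).inner_nonneg_left x)
    (MvPolynomial.aeval g p) (fun t ht => by
      have : MvPolynomial.eval t (MvPolynomial.aeval g p)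
          = MvPolynomial.eval (fun j => 2 * R * t j - R) p := by
        have : (MvPolynomial.aeval t).comp (MvPolynomial.aeval g)
            = MvPolynomial.aeval (R := ℝ) (fun j => 2 * R * t j - R) := by
          refine MvPolynomial.algHom_ext fun j => ?_
          simp [hg]
        simpa [MvPolynomial.aeval_eq_eval] using congrArg (fun f => f p) this
      rw [this]
      refine hp _ fun j => ?_
      rw [abs_le]
      constructor <;> nlinarith [(ht j).1, (ht j).2])
  rw [hcg] at key
  exact key

/-- Every vector has a representing measure on the cube for the polynomial calculus. -/
theorem exists_moment_measure (hsa : ∀ j, IsSelfAdjoint (π (MvPolynomial.X j))) {R : ℝ}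
    (hR : 0 < R) (hA : ∀ j, ‖π (MvPolynomial.X j)‖ ≤ R) (x : H) :
    ∃ μ : Measure (Fin d → ℝ), IsFiniteMeasure μ ∧ μ (box d R)ᶜ = 0 ∧
      ∀ p, ∫ z, MvPolynomial.eval z p ∂μ = ⟪π p x, x⟫_ℝ := by
  have : CompactSpace (box d R) := isCompact_iff_compactSpace.1 (isCompact_box d R)
  let T : MvPolynomial (Fin d) ℝ →ₗ[ℝ] C(box d R, ℝ) :=
    { toFun := fun p => ⟨fun z => MvPolynomial.eval (z : Fin d → ℝ) p,
        (MvPolynomial.continuous_eval p).comp continuous_subtype_val⟩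
      map_add' := fun p q => by ext; simp
      map_smul' := fun a p => by ext; simp }
  let L : MvPolynomial (Fin d) ℝ →ₗ[ℝ] ℝ :=
    { toFun := fun q => ⟪π q x, x⟫_ℝ
      map_add' := fun q r => by simp [inner_add_left]
      map_smul' := fun a q => by simp [inner_smul_left] }
  have hpos : ∀ p, 0 ≤ T p → 0 ≤ L p := fun p hp =>
    polynomial_isPositive π hsa hR hA p (fun z hz => hp ⟨z, hz⟩) x
  -- A polynomial vanishing on the cube is both nonnegative and nonpositive there, so L depends only
  -- on the restriction to the cube.
  have hker : LinearMap.ker T ≤ LinearMap.ker L := by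
    intro p hp
    rw [LinearMap.mem_ker] at hp ⊢
    have h1 := hpos p hp.ge
    have h2 := hpos (-p) (by rw [map_neg, hp, neg_zero])
    rw [map_neg] at h2
    linarith
  let f : C(box d R, ℝ) →ₗ.[ℝ] ℝ := ⟨LinearMap.range T,
    (LinearMap.ker T).liftQ L hker ∘ₗ T.quotKerEquivRange.symm.toLinearMap⟩
  have hf : ∀ p (h : T p ∈ LinearMap.range T), f ⟨T p, h⟩ = L p := fun p h => by
    change (LinearMap.ker T).liftQ L hker (T.quotKerEquivRange.symm ⟨T p, h⟩) = L p
    rw [LinearMap.quotKerEquivRange_symm_apply_image]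
    simp
  -- Constants are polynomials, and ‖y‖ + y ≥ 0 for each continuous y; this is the cofinality that
  -- the extension theorem requires.
  obtain ⟨G, hG1, hG2⟩ := riesz_extension (PointedCone.positive ℝ C(box d R, ℝ)) f
    (by
      rintro ⟨_, p, rfl⟩ hp
      exact (hpos p hp).trans_eq (hf p _).symm)
    (fun y => ⟨⟨T (MvPolynomial.C ‖y‖), ⟨_, rfl⟩⟩, fun z => by
      have := (abs_le.1 (y.norm_coe_le_norm z)).1
      simp [T]
      linarith⟩)
  let Λ₀ : CompactlySupportedContinuousMap (box d R) ℝ →ₗ[ℝ] ℝ :=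
    { toFun := fun g => G g.toContinuousMap
      map_add' := fun g h => G.map_add g.toContinuousMap h.toContinuousMap
      map_smul' := fun a g => G.map_smul a g.toContinuousMap }
  let Λ : CompactlySupportedContinuousMap (box d R) ℝ →ₚ[ℝ] ℝ :=
    PositiveLinearMap.mk₀ Λ₀ fun g hg => hG2 _ hg
  have hfin : IsFiniteMeasure (RealRMK.rieszMeasure Λ) := by
    have := RealRMK.regular_rieszMeasure Λ
    infer_instance
  refine ⟨(RealRMK.rieszMeasure Λ).map Subtype.val, inferInstance, ?_, fun p => ?_⟩
  · rw [Measure.map_apply measurable_subtype_coe (measurableSet_box d R).compl]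
    simp
  · rw [integral_map measurable_subtype_coe.aemeasurable
      (MvPolynomial.continuous_eval p).aestronglyMeasurable]
    have := RealRMK.integral_rieszMeasure Λ (CompactlySupportedContinuousMap.continuousMapEquiv (T p))
    refine Eq.trans this ?_
    refine Eq.trans ?_ (hf p ⟨p, rfl⟩)
    exact hG1 ⟨T p, ⟨p, rfl⟩⟩

end Moments

/-! ### Generating measurable functions from coordinates -/

section BorelInduction

variable {d : ℕ} {R : ℝ}

/-- Measurable functions on `ℝ^d` that are bounded on the cube `[-R, R]^d`. -/
def BddOnBox (R : ℝ) (f : (Fin d → ℝ) → ℝ) : Prop :=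
  Measurable f ∧ ∃ C, ∀ z ∈ box d R, |f z| ≤ C

namespace BddOnBox

theorem const (c : ℝ) : BddOnBox R (fun _ : Fin d → ℝ => c) :=
  ⟨measurable_const, |c|, fun _ _ => le_rfl⟩

theorem coord (j : Fin d) : BddOnBox R (fun z : Fin d → ℝ => z j) :=
  ⟨measurable_pi_apply j, R, fun _ hz => hz j⟩

theorem of_continuous {f : (Fin d → ℝ) → ℝ} (hf : Continuous f) : BddOnBox R f :=
  ⟨hf.measurable, (isCompact_box d R).exists_bound_of_continuousOn hf.continuousOn⟩

theorem of_abs_le {f : (Fin d → ℝ) → ℝ} (hf : Measurable f) {C : ℝ} (h : ∀ z, |f z| ≤ C) :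
    BddOnBox R f :=
  ⟨hf, C, fun z _ => h z⟩

variable {f g : (Fin d → ℝ) → ℝ}

theorem add (hf : BddOnBox R f) (hg : BddOnBox R g) : BddOnBox R (f + g) := by
  obtain ⟨hf, C, hC⟩ := hf
  obtain ⟨hg, D, hD⟩ := hg
  exact ⟨hf.add hg, C + D, fun z hz => (abs_add_le _ _).trans (add_le_add (hC z hz) (hD z hz))⟩

theorem mul (hf : BddOnBox R f) (hg : BddOnBox R g) : BddOnBox R (f * g) := by
  obtain ⟨hf, C, hC⟩ := hf
  obtain ⟨hg, D, hD⟩ := hg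
  refine ⟨hf.mul hg, C * D, fun z hz => ?_⟩
  rw [Pi.mul_apply, abs_mul]
  exact mul_le_mul (hC z hz) (hD z hz) (abs_nonneg _) ((abs_nonneg _).trans (hC z hz))

theorem smul (c : ℝ) (hf : BddOnBox R f) : BddOnBox R (c • f) := (const c).mul hf

theorem neg (hf : BddOnBox R f) : BddOnBox R (-f) := by
  have := hf.smul (-1)
  rwa [neg_one_smul] at this

theorem sub (hf : BddOnBox R f) (hg : BddOnBox R g) : BddOnBox R (f - g) := by
  rw [sub_eq_add_neg]; exact hf.add hg.neg

theorem indicator {s : Set (Fin d → ℝ)} (hs : MeasurableSet s) :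
    BddOnBox R (s.indicator fun _ => (1 : ℝ)) :=
  of_abs_le (C := 1) (measurable_const.indicator hs) fun z => by
    by_cases hz : z ∈ s <;> simp [hz]

end BddOnBox

theorem isCountablySpanning_range_Ioi : IsCountablySpanning (Set.range (Set.Ioi : ℝ → Set ℝ)) := by
  refine ⟨fun n : ℕ => Set.Ioi (-(n : ℝ)), fun n => ⟨_, rfl⟩, ?_⟩
  refine Set.eq_univ_of_forall fun x => Set.mem_iUnion.2 ?_
  obtain ⟨n, hn⟩ := exists_nat_gt (-x)
  exact ⟨n, by simp only [Set.mem_Ioi]; linarith⟩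

/-- A class of functions on `ℝ^d` that contains the constants and the coordinates and is closed
under sums, products and bounded pointwise limits on the cube contains all measurable functions
that are bounded on the cube. -/
theorem borel_induction (P : ((Fin d → ℝ) → ℝ) → Prop) (const : ∀ c : ℝ, P fun _ => c)
    (coord : ∀ j, P fun z => z j)
    (add : ∀ f g, BddOnBox R f → BddOnBox R g → P f → P g → P (f + g))
    (mul : ∀ f g, BddOnBox R f → BddOnBox R g → P f → P g → P (f * g))
    (lim : ∀ (f : ℕ → (Fin d → ℝ) → ℝ) (g : (Fin d → ℝ) → ℝ) (C : ℝ), (∀ n, Measurable (f n)) →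
      Measurable g → (∀ n, ∀ z ∈ box d R, |f n z| ≤ C) →
      (∀ z ∈ box d R, Tendsto (fun n => f n z) atTop (𝓝 (g z))) → (∀ n, P (f n)) → P g)
    {f : (Fin d → ℝ) → ℝ} (hf : BddOnBox R f) : P f := by
  have poly : ∀ j (q : Polynomial ℝ), P fun z => q.eval (z j) := by
    intro j q
    induction q using Polynomial.induction_on' with
    | add p q hp hq =>
      have := add _ _ (.of_continuous (p.continuous.comp (continuous_apply j)))
        (.of_continuous (q.continuous.comp (continuous_apply j))) hp hq
      convert this using 2 with z
      simp
    | monomial n a =>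
      have hpow : P fun z => z j ^ n := by
        induction n with
        | zero => simpa using const 1
        | succ n ih =>
          simp_rw [pow_succ]
          exact mul _ _ (.of_continuous (by fun_prop)) (.coord j) ih (coord j)
      have := mul _ _ (.const a) (.of_continuous (by fun_prop)) (const a) hpow
      convert this using 2 with z
      simp
  have cont : ∀ j (φ : ℝ → ℝ), Continuous φ → P fun z => φ (z j) := by
    intro j φ hφ
    -- Weierstrass approximation on [-R, R]; only values on the cube matter for `lim`.
    have happ := fun n : ℕ => exists_polynomial_near_of_continuousOn (-R) R φ hφ.continuousOn
      (1 / ((n : ℝ) + 1)) (by positivity)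
    choose q hq using happ
    obtain ⟨C, hC⟩ := isCompact_Icc.exists_bound_of_continuousOn (s := Set.Icc (-R) R)
      hφ.continuousOn
    have hmem : ∀ z ∈ box d R, z j ∈ Set.Icc (-R) R := fun z hz => abs_le.1 (hz j)
    refine lim (fun n z => (q n).eval (z j)) _ (1 + C) (fun n => ?_) ?_ ?_ ?_ fun n => poly j _
    · exact ((q n).continuous.comp (continuous_apply j)).measurable
    · exact (hφ.comp (continuous_apply j)).measurable
    · intro n z hz
      have h1 := (hq n _ (hmem z hz)).le.trans (div_le_one_of_le₀ (by simp) (by positivity))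
      have h2 : |φ (z j)| ≤ C := hC _ (hmem z hz)
      have := abs_add_le ((q n).eval (z j) - φ (z j)) (φ (z j))
      rw [sub_add_cancel] at this
      linarith
    · intro z hz
      rw [tendsto_iff_norm_sub_tendsto_zero]
      exact squeeze_zero (fun _ => norm_nonneg _) (fun n => (hq n _ (hmem z hz)).le)
        tendsto_one_div_add_atTop_nhds_zero_nat
  have hIoi : ∀ j (a : ℝ), P ({z | a < z j}.indicator fun _ => (1 : ℝ)) := by
    intro j a
    -- These continuous ramps increase to the indicator of {a < z_j}.
    refine lim (fun n z => min 1 (n * max 0 (z j - a))) _ 1 (fun n => by fun_prop)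
      (measurable_const.indicator (measurableSet_lt measurable_const (measurable_pi_apply j)))
      ?_ ?_ fun n => cont j (fun t => min 1 (n * max 0 (t - a))) (by fun_prop)
    · intro n z _
      rw [abs_of_nonneg (by positivity)]
      exact min_le_left _ _
    · intro z _
      by_cases h : a < z j
      · rw [Set.indicator_of_mem (by exact h)]
        refine tendsto_const_nhds.congr' ?_
        obtain ⟨N, hN⟩ := exists_nat_ge (1 / (z j - a))
        filter_upwards [eventually_ge_atTop N] with n hn
        have h0 : 0 < z j - a := sub_pos.2 h
        rw [max_eq_right h0.le, eq_comm, min_eq_left]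
        rw [div_le_iff₀ h0] at hN
        exact hN.trans (by gcongr)
      · rw [Set.indicator_of_notMem (by exact h), max_eq_left (by linarith)]
        simp
  have hQmul : ∀ f g : (Fin d → ℝ) → ℝ, (BddOnBox R f ∧ P f) → (BddOnBox R g ∧ P g) →
      (BddOnBox R (f * g) ∧ P (f * g)) :=
    fun f g hf hg => ⟨hf.1.mul hg.1, mul _ _ hf.1 hg.1 hf.2 hg.2⟩
  have hbox : ∀ a : Fin d → ℝ,
      P ((Set.univ.pi fun j => Set.Ioi (a j)).indicator fun _ => (1 : ℝ)) := by
    intro a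
    have h := Finset.prod_induction (s := Finset.univ)
      (fun j : Fin d => {z : Fin d → ℝ | a j < z j}.indicator fun _ => (1 : ℝ))
      (fun f => BddOnBox R f ∧ P f) hQmul ⟨.const 1, const 1⟩ fun j _ =>
        ⟨.indicator (measurableSet_lt measurable_const (measurable_pi_apply j)), hIoi j (a j)⟩
    convert h.2 using 1
    ext z
    rw [Finset.prod_apply]
    by_cases hz : ∀ j, a j < z j
    · rw [Set.indicator_of_mem (by simpa using hz), Finset.prod_eq_one]
      intro j _
      exact Set.indicator_of_mem (show z ∈ {z | a j < z j} from hz j) _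
    · rw [Set.indicator_of_notMem (by simpa using hz)]
      push Not at hz
      obtain ⟨j, hj⟩ := hz
      exact (Finset.prod_eq_zero (Finset.mem_univ j)
        (Set.indicator_of_notMem (show z ∉ {z | a j < z j} from not_lt.2 hj) _)).symm
  have hset : ∀ s : Set (Fin d → ℝ), MeasurableSet s → P (s.indicator fun _ => (1 : ℝ)) := by
    intro s hs
    -- Products of open half-lines form a π-system generating the σ-algebra, so Dynkin's theorem
    -- leaves only complements and disjoint unions to check.
    have hgen : (MeasurableSpace.pi : MeasurableSpace (Fin d → ℝ)) =
        MeasurableSpace.generateFrom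
          (Set.univ.pi '' Set.univ.pi fun _ : Fin d => Set.range (Set.Ioi : ℝ → Set ℝ)) :=
      (generateFrom_eq_pi (fun _ => (borel_eq_generateFrom_Ioi ℝ).symm.trans
        (BorelSpace.measurable_eq (α := ℝ)).symm) fun _ => isCountablySpanning_range_Ioi).symm
    induction s, hs using MeasurableSpace.induction_on_inter hgen
      (IsPiSystem.pi fun _ => isPiSystem_Ioi) with
    | empty => simpa using const 0
    | basic t ht =>
      obtain ⟨u, hu, rfl⟩ := ht
      choose a ha using fun j => hu j (Set.mem_univ j)
      obtain rfl : (fun j => Set.Ioi (a j)) = u := funext ha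
      exact hbox a
    | compl t ht ih =>
      have h := add _ _ (.const 1) ((BddOnBox.const (-1)).mul (.indicator ht)) (const 1)
        (mul _ _ (.const (-1)) (.indicator ht) (const (-1)) ih)
      convert h using 1
      ext z
      by_cases hz : z ∈ t <;> simp [hz]
    | iUnion t hd ht ih =>
      have hpart : ∀ n : ℕ, P ((⋃ k ∈ Finset.range n, t k).indicator fun _ => (1 : ℝ)) := by
        intro n
        induction n with
        | zero => simpa using const 0
        | succ n hn =>
          have h := add _ _ (.indicator (Finset.measurableSet_biUnion _ fun k _ => ht k))
            (.indicator (ht n)) hn (ih n)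
          convert h using 1
          refine Eq.trans ?_ (Set.indicator_union_of_disjoint ?_ _)
          · rw [Finset.range_add_one, Finset.set_biUnion_insert, Set.union_comm]
          · rw [Set.disjoint_iUnion₂_left]
            exact fun k hk => hd (Finset.mem_range.1 hk).ne
      refine lim _ _ 1 (fun n => measurable_const.indicator
        (Finset.measurableSet_biUnion _ fun k _ => ht k))
        (measurable_const.indicator (MeasurableSet.iUnion ht)) ?_ ?_ hpart
      · intro n z _
        by_cases hz : z ∈ ⋃ k ∈ Finset.range n, t k
        · rw [Set.indicator_of_mem hz]; simp
        · rw [Set.indicator_of_notMem hz]; simp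
      · intro z _
        by_cases hz : z ∈ ⋃ k, t k
        · rw [Set.indicator_of_mem hz]
          obtain ⟨k, hk⟩ := Set.mem_iUnion.1 hz
          refine tendsto_const_nhds.congr' ?_
          filter_upwards [eventually_gt_atTop k] with n hn
          rw [Set.indicator_of_mem]
          exact Set.mem_iUnion₂.2 ⟨k, Finset.mem_range.2 hn, hk⟩
        · rw [Set.indicator_of_notMem hz]
          refine tendsto_const_nhds.congr fun n => ?_
          rw [Set.indicator_of_notMem]
          intro h
          obtain ⟨k, _, hk⟩ := Set.mem_iUnion₂.1 h
          exact hz (Set.mem_iUnion.2 ⟨k, hk⟩)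
  have hsimple : ∀ s : SimpleFunc (Fin d → ℝ) ℝ, BddOnBox R s ∧ P s := by
    intro s
    induction s using SimpleFunc.induction with
    | @const c t hs =>
      have h := hQmul _ _ ⟨.const c, const c⟩ ⟨.indicator hs, hset _ hs⟩
      convert h using 2 <;>
      · ext z
        by_cases hz : z ∈ t <;> simp [SimpleFunc.coe_piecewise, Set.piecewise, Set.indicator, hz]
    | add hd hf hg => exact ⟨hf.1.add hg.1, add _ _ hf.1 hg.1 hf.2 hg.2⟩
  obtain ⟨hm, C, hC⟩ := hf
  have hsm := hm.stronglyMeasurable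
  refine lim (fun n => hsm.approxBounded |C| n) f |C| (fun n => SimpleFunc.measurable _) hm
    (fun n z _ => StronglyMeasurable.norm_approxBounded_le hsm (abs_nonneg C) n z)
    (fun z hz => StronglyMeasurable.tendsto_approxBounded_of_norm_le hsm
      ((hC z hz).trans (le_abs_self C))) fun n => (hsimple _).2

end BorelInduction

/-! ### Polynomial approximation in L² -/

section Approximation

variable {d : ℕ} {R : ℝ} {ν ν' : Measure (Fin d → ℝ)}

theorem BddOnBox.polynomial (p : MvPolynomial (Fin d) ℝ) :
    BddOnBox R fun z => MvPolynomial.eval z p :=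
  .of_continuous (MvPolynomial.continuous_eval p)

theorem ae_mem_box (hν : ν (box d R)ᶜ = 0) : ∀ᵐ z ∂ν, z ∈ box d R :=
  mem_ae_iff.2 hν

theorem BddOnBox.integrable [IsFiniteMeasure ν] (hν : ν (box d R)ᶜ = 0) {f : (Fin d → ℝ) → ℝ}
    (hf : BddOnBox R f) : Integrable f ν := by
  obtain ⟨hm, C, hC⟩ := hf
  exact Integrable.of_bound hm.aestronglyMeasurable C ((ae_mem_box hν).mono hC)

theorem BddOnBox.sq_sub {f g : (Fin d → ℝ) → ℝ} (hf : BddOnBox R f) (hg : BddOnBox R g) :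
    BddOnBox R fun z => (f z - g z) ^ 2 := by
  simp_rw [pow_two]
  exact (hf.sub hg).mul (hf.sub hg)

theorem integral_sq_sub_le [IsFiniteMeasure ν] (hν : ν (box d R)ᶜ = 0)
    {f g h : (Fin d → ℝ) → ℝ} (hf : BddOnBox R f) (hg : BddOnBox R g) (hh : BddOnBox R h) :
    ∫ z, (f z - h z) ^ 2 ∂ν ≤ 2 * ∫ z, (f z - g z) ^ 2 ∂ν + 2 * ∫ z, (g z - h z) ^ 2 ∂ν := by
  have h1 := ((hf.sq_sub hg).integrable hν).const_mul 2
  have h2 := ((hg.sq_sub hh).integrable hν).const_mul 2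
  rw [← integral_const_mul, ← integral_const_mul, ← integral_add h1 h2]
  refine integral_mono ((hf.sq_sub hh).integrable hν) (h1.add h2) fun z => ?_
  have := sq_nonneg ((f z - g z) - (g z - h z))
  nlinarith

theorem integral_sq_mul_le [IsFiniteMeasure ν] (hν : ν (box d R)ᶜ = 0)
    {f g h : (Fin d → ℝ) → ℝ} (hf : BddOnBox R f) {C : ℝ} (hC : ∀ z ∈ box d R, |f z| ≤ C)
    (hg : BddOnBox R g) (hh : BddOnBox R h) :
    ∫ z, (f z * g z - f z * h z) ^ 2 ∂ν ≤ C ^ 2 * ∫ z, (g z - h z) ^ 2 ∂ν := by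
  rw [← integral_const_mul]
  refine integral_mono_ae (((hf.mul hg).sq_sub (hf.mul hh)).integrable hν)
    (((hg.sq_sub hh).integrable hν).const_mul _) ((ae_mem_box hν).mono fun z hz => ?_)
  simp only
  rw [← mul_sub, mul_pow, ← sq_abs (f z)]
  gcongr
  exact hC z hz

theorem BddOnBox.of_tendsto {f : ℕ → (Fin d → ℝ) → ℝ} {g : (Fin d → ℝ) → ℝ} {C : ℝ}
    (hgm : Measurable g) (hC : ∀ n, ∀ z ∈ box d R, |f n z| ≤ C)
    (hlim : ∀ z ∈ box d R, Tendsto (fun n => f n z) atTop (𝓝 (g z))) : BddOnBox R g :=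
  ⟨hgm, C, fun z hz => le_of_tendsto' (hlim z hz).abs fun n => hC n z hz⟩

theorem tendsto_integral_sq_sub [IsFiniteMeasure ν] (hν : ν (box d R)ᶜ = 0)
    {f : ℕ → (Fin d → ℝ) → ℝ} {g : (Fin d → ℝ) → ℝ} {C : ℝ} (hfm : ∀ n, Measurable (f n))
    (hgm : Measurable g) (hC : ∀ n, ∀ z ∈ box d R, |f n z| ≤ C)
    (hlim : ∀ z ∈ box d R, Tendsto (fun n => f n z) atTop (𝓝 (g z))) :
    Tendsto (fun n => ∫ z, (g z - f n z) ^ 2 ∂ν) atTop (𝓝 0) := by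
  have := tendsto_integral_of_dominated_convergence (μ := ν) (f := fun _ => (0 : ℝ))
    (F := fun n z => (g z - f n z) ^ 2) (fun _ => (2 * C) ^ 2)
    (fun n => ((hgm.sub (hfm n)).pow_const 2).aestronglyMeasurable) (integrable_const _)
    (fun n => (ae_mem_box hν).mono fun z hz => ?_)
    ((ae_mem_box hν).mono fun z hz => ?_)
  · simpa using this
  · rw [Real.norm_eq_abs, abs_pow]
    have h1 := hC n z hz
    have h2 : |g z| ≤ C := le_of_tendsto' (hlim z hz).abs fun n => hC n z hz
    have := abs_sub (g z) (f n z)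
    gcongr
    linarith
  · have := ((tendsto_const_nhds (x := g z)).sub (hlim z hz)).pow 2
    simpa using this

/-- Convergence of a sequence of polynomials to a function in `L²(ν)`. -/
def L2Approx (ν : Measure (Fin d → ℝ)) (f : (Fin d → ℝ) → ℝ)
    (p : ℕ → MvPolynomial (Fin d) ℝ) : Prop :=
  Tendsto (fun n => ∫ z, (f z - MvPolynomial.eval z (p n)) ^ 2 ∂ν) atTop (𝓝 0)

/-- Functions approximable by polynomials in L²(ν) form a class to which `borel_induction` applies;
bounded limits are handled by dominated convergence. -/
theorem exists_L2Approx [IsFiniteMeasure ν] (hν : ν (box d R)ᶜ = 0)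
    {f : (Fin d → ℝ) → ℝ} (hf : BddOnBox R f) : ∃ p, L2Approx ν f p := by
  suffices h : ∀ ε > 0, ∃ p : MvPolynomial (Fin d) ℝ,
      ∫ z, (f z - MvPolynomial.eval z p) ^ 2 ∂ν ≤ ε by
    choose p hp using fun n : ℕ => h (1 / ((n : ℝ) + 1)) (by positivity)
    exact ⟨p, squeeze_zero (fun n => integral_nonneg fun z => sq_nonneg _) hp
      tendsto_one_div_add_atTop_nhds_zero_nat⟩
  refine borel_induction (R := R) (fun f => ∀ ε > 0, ∃ p : MvPolynomial (Fin d) ℝ,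
      ∫ z, (f z - MvPolynomial.eval z p) ^ 2 ∂ν ≤ ε) ?_ ?_ ?_ ?_ ?_ hf
  · exact fun c ε hε => ⟨MvPolynomial.C c, by simpa using hε.le⟩
  · exact fun j ε hε => ⟨MvPolynomial.X j, by simpa using hε.le⟩
  · intro f g hf hg hPf hPg ε hε
    obtain ⟨p, hp⟩ := hPf (ε / 4) (by positivity)
    obtain ⟨q, hq⟩ := hPg (ε / 4) (by positivity)
    refine ⟨p + q, (integral_sq_sub_le hν (hf.add hg) ((BddOnBox.polynomial p).add hg)
      (BddOnBox.polynomial (p + q))).trans ?_⟩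
    simp only [Pi.add_apply, map_add, add_sub_add_right_eq_sub, add_sub_add_left_eq_sub]
    linarith
  · intro f g hf hg hPf hPg ε hε
    -- From fg - qp = f(g - q) + q(f - p): q is chosen first, against the bound C of f, and only
    -- then p, against the bound D of q.
    obtain ⟨C, hC⟩ := hf.2
    obtain ⟨q, hq⟩ := hPg (ε / (4 * (C ^ 2 + 1))) (by positivity)
    obtain ⟨D, hD⟩ := (BddOnBox.polynomial (R := R) q).2
    obtain ⟨p, hp⟩ := hPf (ε / (4 * (D ^ 2 + 1))) (by positivity)
    refine ⟨q * p, (integral_sq_sub_le hν (hf.mul hg) (hf.mul (BddOnBox.polynomial q))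
      (BddOnBox.polynomial (q * p))).trans ?_⟩
    have h1 := integral_sq_mul_le hν hf hC hg (BddOnBox.polynomial q)
    have h2 := integral_sq_mul_le hν (BddOnBox.polynomial q) hD hf (BddOnBox.polynomial p)
    have aux : ∀ {E e : ℝ}, e ≤ ε / (4 * (E ^ 2 + 1)) → E ^ 2 * e ≤ ε / 4 := by
      intro E e he
      refine (mul_le_mul_of_nonneg_left he (sq_nonneg E)).trans ?_
      rw [mul_div_assoc', div_le_div_iff₀ (by positivity) (by norm_num)]
      nlinarith
    have h3 := h1.trans (aux hq)
    have h4 := h2.trans (aux hp)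
    simp only [Pi.mul_apply, map_mul]
    simp_rw [fun z => mul_comm (f z) (MvPolynomial.eval z q)] at h3 ⊢
    linarith
  · intro f g C hfm hgm hC hlim hP ε hε
    have hg : BddOnBox R g := .of_tendsto hgm hC hlim
    have ht := tendsto_integral_sq_sub hν hfm hgm hC hlim
    obtain ⟨n, hn⟩ := (ht.eventually (gt_mem_nhds (show 0 < ε / 4 by positivity))).exists
    obtain ⟨p, hp⟩ := hP n (ε / 4) (by positivity)
    refine ⟨p, (integral_sq_sub_le hν hg ⟨hfm n, C, hC n⟩ (BddOnBox.polynomial p)).trans ?_⟩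
    linarith

theorem L2Approx.of_add [IsFiniteMeasure ν] [IsFiniteMeasure ν'] (hν : ν (box d R)ᶜ = 0)
    (hν' : ν' (box d R)ᶜ = 0) {f : (Fin d → ℝ) → ℝ} (hf : BddOnBox R f)
    {p : ℕ → MvPolynomial (Fin d) ℝ} (h : L2Approx (ν + ν') f p) :
    L2Approx ν f p ∧ L2Approx ν' f p := by
  have e : ∀ n, ∫ z, (f z - MvPolynomial.eval z (p n)) ^ 2 ∂(ν + ν') =
      ∫ z, (f z - MvPolynomial.eval z (p n)) ^ 2 ∂ν +
      ∫ z, (f z - MvPolynomial.eval z (p n)) ^ 2 ∂ν' := fun n =>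
    integral_add_measure ((hf.sq_sub (.polynomial _)).integrable hν)
      ((hf.sq_sub (.polynomial _)).integrable hν')
  have h1 : ∀ (ν : Measure (Fin d → ℝ)) n, 0 ≤ ∫ z, (f z - MvPolynomial.eval z (p n)) ^ 2 ∂ν :=
    fun _ _ => integral_nonneg fun z => sq_nonneg _
  refine ⟨squeeze_zero (h1 ν) (fun n => ?_) h, squeeze_zero (h1 ν') (fun n => ?_) h⟩
  · rw [e]; linarith [h1 ν' n]
  · rw [e]; linarith [h1 ν n]

/-- Approximation in L²(ν + ν') works for both measures at once. This is needed to compare values of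
the calculus at different vectors, whose measures differ. -/
theorem exists_L2Approx₂ [IsFiniteMeasure ν] [IsFiniteMeasure ν'] (hν : ν (box d R)ᶜ = 0)
    (hν' : ν' (box d R)ᶜ = 0) {f : (Fin d → ℝ) → ℝ} (hf : BddOnBox R f) :
    ∃ p, L2Approx ν f p ∧ L2Approx ν' f p := by
  obtain ⟨p, hp⟩ := exists_L2Approx (ν := ν + ν') (R := R) (by simp [hν, hν']) hf
  exact ⟨p, hp.of_add hν hν' hf⟩

theorem exists_L2Approx₃ {ν'' : Measure (Fin d → ℝ)} [IsFiniteMeasure ν] [IsFiniteMeasure ν']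
    [IsFiniteMeasure ν''] (hν : ν (box d R)ᶜ = 0) (hν' : ν' (box d R)ᶜ = 0)
    (hν'' : ν'' (box d R)ᶜ = 0) {f : (Fin d → ℝ) → ℝ} (hf : BddOnBox R f) :
    ∃ p, L2Approx ν f p ∧ L2Approx ν' f p ∧ L2Approx ν'' f p := by
  obtain ⟨p, h1, h2⟩ := exists_L2Approx₂ (ν := ν) (ν' := ν' + ν'') (R := R) hν
    (by simp [hν', hν'']) hf
  exact ⟨p, h1, h2.of_add hν' hν'' hf⟩

end Approximation

/-! ### The bounded calculus on the cube -/

section BoxCalculus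

variable {H : Type*} [NormedAddCommGroup H] [InnerProductSpace ℝ H] {d : ℕ}
  {R : ℝ}

variable [CompleteSpace H] in
/-- A calculus of bounded self-adjoint operators for the measurable functions on `ℝ^d` that are
bounded on the cube `[-R, R]^d`. -/
structure IsBoxCalculus (R : ℝ) (Ψ : ((Fin d → ℝ) → ℝ) → H →L[ℝ] H) : Prop where
  map_one : Ψ 1 = 1
  map_add : ∀ {f g}, BddOnBox R f → BddOnBox R g → Ψ (f + g) = Ψ f + Ψ g
  map_mul : ∀ {f g}, BddOnBox R f → BddOnBox R g → Ψ (f * g) = Ψ f * Ψ g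
  map_smul : ∀ (c : ℝ) {f}, BddOnBox R f → Ψ (c • f) = c • Ψ f
  isSelfAdjoint : ∀ {f}, BddOnBox R f → IsSelfAdjoint (Ψ f)
  tendsto : ∀ {f : ℕ → (Fin d → ℝ) → ℝ} {g : (Fin d → ℝ) → ℝ} {C : ℝ}, (∀ n, Measurable (f n)) →
    Measurable g → (∀ n, ∀ z ∈ box d R, |f n z| ≤ C) →
    (∀ z ∈ box d R, Tendsto (fun n => f n z) atTop (𝓝 (g z))) →
    ∀ x, Tendsto (fun n => Ψ (f n) x) atTop (𝓝 (Ψ g x))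

variable (π : MvPolynomial (Fin d) ℝ →ₐ[ℝ] (H →L[ℝ] H)) (μ : H → Measure (Fin d → ℝ))

/-- The vector `y` is the value at `x` of the Borel calculus applied to `f`, characterized by
polynomial approximation of `f` in `L²(μ x)`. -/
def IsBorelValue (f : (Fin d → ℝ) → ℝ) (x y : H) : Prop :=
  ∀ p, ‖y - π p x‖ ^ 2 ≤ 4 * ∫ z, (f z - MvPolynomial.eval z p) ^ 2 ∂μ x

variable {π μ}

theorem IsBorelValue.tendsto {f : (Fin d → ℝ) → ℝ} {x y : H} (h : IsBorelValue π μ f x y)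
    {p : ℕ → MvPolynomial (Fin d) ℝ} (hp : L2Approx (μ x) f p) :
    Tendsto (fun n => π (p n) x) atTop (𝓝 y) := by
  rw [tendsto_iff_norm_sub_tendsto_zero]
  have h1 : Tendsto (fun n => ‖π (p n) x - y‖ ^ 2) atTop (𝓝 0) :=
    squeeze_zero (fun n => by positivity) (fun n => (norm_sub_rev (π (p n) x) y ▸ h (p n) :
      _ ≤ 4 * ∫ z, (f z - MvPolynomial.eval z (p n)) ^ 2 ∂μ x)) (by simpa using hp.const_mul 4)
  simpa using h1.sqrt

variable [CompleteSpace H]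

/-- By self-adjointness ‖π(p)x‖² = ⟨π(p²)x, x⟩. This isometry is what lets p ↦ π(p)x extend to
L²(μ_x). -/
theorem norm_sq_polynomial (hsa : ∀ j, IsSelfAdjoint (π (MvPolynomial.X j)))
    (hm : ∀ x p, ∫ z, MvPolynomial.eval z p ∂μ x = ⟪π p x, x⟫_ℝ)
    (p : MvPolynomial (Fin d) ℝ) (x : H) :
    ‖π p x‖ ^ 2 = ∫ z, MvPolynomial.eval z p ^ 2 ∂μ x := by
  have := hm x (p * p)
  rw [map_mul, inner_sq_apply (polynomial_isSelfAdjoint π hsa p)] at this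
  rw [← this]
  simp [pow_two]

theorem exists_isBorelValue [∀ x, IsFiniteMeasure (μ x)] (hμ : ∀ x, μ x (box d R)ᶜ = 0)
    (hsa : ∀ j, IsSelfAdjoint (π (MvPolynomial.X j)))
    (hm : ∀ x p, ∫ z, MvPolynomial.eval z p ∂μ x = ⟪π p x, x⟫_ℝ)
    {f : (Fin d → ℝ) → ℝ} (hf : BddOnBox R f) (x : H) : ∃ y, IsBorelValue π μ f x y := by
  obtain ⟨p, hp⟩ := exists_L2Approx (hμ x) hf
  have key : ∀ q r, ‖π q x - π r x‖ ^ 2 ≤ 2 * ∫ z, (f z - MvPolynomial.eval z q) ^ 2 ∂μ x +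
      2 * ∫ z, (f z - MvPolynomial.eval z r) ^ 2 ∂μ x := by
    intro q r
    have h1 := norm_sq_polynomial hsa hm (q - r) x
    have h2 := integral_sq_sub_le (hμ x) (BddOnBox.polynomial q) hf (BddOnBox.polynomial r)
    rw [map_sub, _root_.sub_apply] at h1
    rw [h1]
    simp_rw [fun z => sub_sq_comm (f z) (MvPolynomial.eval z q)]
    simpa using h2
  have hc : CauchySeq fun n => π (p n) x := by
    rw [Metric.cauchySeq_iff]
    intro ε hε
    have h1 : ∀ᶠ n in atTop, ∫ z, (f z - MvPolynomial.eval z (p n)) ^ 2 ∂μ x < ε ^ 2 / 4 :=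
      Tendsto.eventually hp (gt_mem_nhds (by positivity))
    obtain ⟨N, hN⟩ := eventually_atTop.1 h1
    refine ⟨N, fun m hm n hn => ?_⟩
    rw [dist_eq_norm]
    refine lt_of_pow_lt_pow_left₀ 2 hε.le ?_
    linarith [key (p m) (p n), hN m hm, hN n hn]
  obtain ⟨y, hy⟩ := cauchySeq_tendsto_of_complete hc
  refine ⟨y, fun q => ?_⟩
  have h1 : Tendsto (fun n => ‖π (p n) x - π q x‖ ^ 2) atTop (𝓝 (‖y - π q x‖ ^ 2)) :=
    ((hy.sub tendsto_const_nhds).norm).pow 2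
  have h2 : Tendsto (fun n => 2 * ∫ z, (f z - MvPolynomial.eval z (p n)) ^ 2 ∂μ x +
      2 * ∫ z, (f z - MvPolynomial.eval z q) ^ 2 ∂μ x) atTop
      (𝓝 (2 * 0 + 2 * ∫ z, (f z - MvPolynomial.eval z q) ^ 2 ∂μ x)) :=
    (Tendsto.const_mul 2 hp).add tendsto_const_nhds
  -- The limit yields the constant 2; the 4 in `IsBorelValue` is slack, as any constant
  -- characterizes the same y.
  refine (le_of_tendsto_of_tendsto' h1 h2 fun n => key (p n) q).trans ?_
  have : 0 ≤ ∫ z, (f z - MvPolynomial.eval z q) ^ 2 ∂μ x := integral_nonneg fun _ => sq_nonneg _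
  linarith

theorem exists_operator_isBorelValue [∀ x, IsFiniteMeasure (μ x)]
    (hμ : ∀ x, μ x (box d R)ᶜ = 0)
    (hsa : ∀ j, IsSelfAdjoint (π (MvPolynomial.X j)))
    (hm : ∀ x p, ∫ z, MvPolynomial.eval z p ∂μ x = ⟪π p x, x⟫_ℝ)
    {f : (Fin d → ℝ) → ℝ} (hf : BddOnBox R f) :
    ∃ T : H →L[ℝ] H, ∀ x, IsBorelValue π μ f x (T x) := by
  choose V hV using exists_isBorelValue hμ hsa hm hf
  obtain ⟨C, hC⟩ := hf.2
  -- The moment of the constant polynomial 1.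
  have hmass : ∀ x, (μ x).real Set.univ = ‖x‖ ^ 2 := fun x => by
    have := hm x 1
    simpa using this
  let T : H →ₗ[ℝ] H :=
    { toFun := V
      map_add' := fun x y => by
        obtain ⟨p, h1, h2, h3⟩ := exists_L2Approx₃ (hμ x) (hμ y) (hμ (x + y)) hf
        refine tendsto_nhds_unique ((hV _).tendsto h3) ?_
        simp_rw [map_add]
        exact ((hV x).tendsto h1).add ((hV y).tendsto h2)
      map_smul' := fun c x => by
        obtain ⟨p, h1, h2⟩ := exists_L2Approx₂ (hμ x) (hμ (c • x)) hf
        refine tendsto_nhds_unique ((hV _).tendsto h2) ?_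
        simp_rw [map_smul]
        exact ((hV x).tendsto h1).const_smul c }
  refine ⟨T.mkContinuous (2 * |C|) fun x => ?_, hV⟩
  -- Comparison with the zero polynomial bounds ‖V x‖² by 4 ∫ f² dμ_x.
  have h1 := hV x 0
  have h2 : ∫ z, (f z - MvPolynomial.eval z 0) ^ 2 ∂μ x ≤ C ^ 2 * ‖x‖ ^ 2 := by
    have h3 := integral_mono_ae ((hf.sq_sub (.polynomial 0)).integrable (hμ x))
      (integrable_const (C ^ 2)) ((ae_mem_box (hμ x)).mono fun z hz => by
        simp only [map_zero, sub_zero]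
        rw [← sq_abs]
        gcongr
        exact hC z hz)
    rw [integral_const, hmass, smul_eq_mul] at h3
    linarith
  refine le_of_sq_le_sq ?_ (by positivity)
  rw [mul_pow, mul_pow, sq_abs]
  simp only [map_zero, _root_.zero_apply, sub_zero] at h1 h2
  change ‖V x‖ ^ 2 ≤ _
  linarith

theorem exists_isBoxCalculus (hsa : ∀ j, IsSelfAdjoint (π (MvPolynomial.X j)))
    (hR : 0 < R) (hA : ∀ j, ‖π (MvPolynomial.X j)‖ ≤ R) :
    ∃ Ψ : ((Fin d → ℝ) → ℝ) → H →L[ℝ] H, IsBoxCalculus R Ψ ∧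
      ∀ j, Ψ (fun z => z j) = π (MvPolynomial.X j) := by
  classical
  choose μ hfin hμ hm using exists_moment_measure π hsa hR hA
  have hop : ∀ f : (Fin d → ℝ) → ℝ, ∃ T : H →L[ℝ] H, BddOnBox R f →
      ∀ x, IsBorelValue π μ f x (T x) := fun f => by
    by_cases hf : BddOnBox R f
    · obtain ⟨T, hT⟩ := exists_operator_isBorelValue hμ hsa hm hf
      exact ⟨T, fun _ => hT⟩
    -- Default value for functions unbounded on the cube.
    · exact ⟨0, fun h => absurd h hf⟩
  choose Ψ hΨ using hop
  have hpoly : ∀ p, Ψ (fun z => MvPolynomial.eval z p) = π p := fun p => by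
    ext x
    have := hΨ _ (.polynomial p) x p
    simpa [sub_eq_zero] using this
  have hadd : ∀ {f g}, BddOnBox R f → BddOnBox R g → Ψ (f + g) = Ψ f + Ψ g := by
    intro f g hf hg
    ext x
    obtain ⟨p, hp⟩ := exists_L2Approx (hμ x) hf
    obtain ⟨q, hq⟩ := exists_L2Approx (hμ x) hg
    have hpq : L2Approx (μ x) (f + g) (fun n => p n + q n) := by
      refine squeeze_zero (fun n => integral_nonneg fun z => sq_nonneg _) (fun n =>
        integral_sq_sub_le (hμ x) (hf.add hg) ((BddOnBox.polynomial (p n)).add hg)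
        (BddOnBox.polynomial (p n + q n))) ?_
      simp only [Pi.add_apply, map_add, add_sub_add_right_eq_sub, add_sub_add_left_eq_sub]
      simpa using (Tendsto.const_mul 2 hp).add (Tendsto.const_mul 2 hq)
    refine tendsto_nhds_unique ((hΨ _ (hf.add hg) x).tendsto hpq) ?_
    simp_rw [map_add]
    exact ((hΨ _ hf x).tendsto hp).add ((hΨ _ hg x).tendsto hq)
  have hmulpoly : ∀ {f} q, BddOnBox R f → ∀ x,
      Ψ (f * fun z => MvPolynomial.eval z q) x = π q (Ψ f x) := by
    intro f q hf x
    obtain ⟨C, hC⟩ := (BddOnBox.polynomial (R := R) q).2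
    obtain ⟨p, hp⟩ := exists_L2Approx (hμ x) hf
    have hpq : L2Approx (μ x) (f * fun z => MvPolynomial.eval z q) (fun n => q * p n) := by
      refine squeeze_zero (fun n => integral_nonneg fun z => sq_nonneg _) (fun n => ?_)
        (by simpa using Tendsto.const_mul (C ^ 2) hp)
      have := integral_sq_mul_le (hμ x) (.polynomial q) hC hf (BddOnBox.polynomial (p n))
      simpa [mul_comm] using this
    refine tendsto_nhds_unique ((hΨ _ (hf.mul (.polynomial q)) x).tendsto hpq) ?_
    simp_rw [map_mul, mul_apply_eq_comp]
    exact ((π q).continuous.tendsto _).comp ((hΨ _ hf x).tendsto hp)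
  have hcommpoly : ∀ {f} q, BddOnBox R f → ∀ x, Ψ f (π q x) = π q (Ψ f x) := by
    intro f q hf x
    obtain ⟨p, hp1, hp2⟩ := exists_L2Approx₂ (hμ x) (hμ (π q x)) hf
    refine tendsto_nhds_unique ((hΨ _ hf _).tendsto hp2) ?_
    have := ((π q).continuous.tendsto _).comp ((hΨ _ hf x).tendsto hp1)
    refine this.congr fun n => ?_
    exact congrArg (fun T : H →L[ℝ] H => T x) (polynomial_commute π q (p n)).eq
  have hconst : ∀ c : ℝ, Ψ (fun _ => c) = c • 1 := fun c => by
    have := hpoly (MvPolynomial.C c)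
    simp only [MvPolynomial.eval_C] at this
    rw [this, ← MvPolynomial.algebraMap_eq, AlgHom.commutes, Algebra.algebraMap_eq_smul_one]
  have hsmul : ∀ (c : ℝ) {f}, BddOnBox R f → Ψ (c • f) = c • Ψ f := by
    intro c f hf
    ext x
    have h1 := hmulpoly (MvPolynomial.C c) hf x
    have h2 : (f * fun z => MvPolynomial.eval z (MvPolynomial.C c)) = c • f := by
      ext z; simp [mul_comm]
    rw [h2, ← hpoly] at h1
    simp only [MvPolynomial.eval_C, hconst] at h1
    simpa using h1
  have htendsto : ∀ {f : ℕ → (Fin d → ℝ) → ℝ} {g : (Fin d → ℝ) → ℝ} (x : H),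
      (∀ n, BddOnBox R (f n)) → BddOnBox R g →
      Tendsto (fun n => ∫ z, (g z - f n z) ^ 2 ∂μ x) atTop (𝓝 0) →
      Tendsto (fun n => Ψ (f n) x) atTop (𝓝 (Ψ g x)) := by
    intro f g x hf hg h
    rw [tendsto_iff_norm_sub_tendsto_zero]
    have h1 : Tendsto (fun n => ‖Ψ (f n) x - Ψ g x‖ ^ 2) atTop (𝓝 0) := by
      refine squeeze_zero (fun n => by positivity) (fun n => ?_)
        (by simpa using h.const_mul 4)
      -- The zero polynomial again: ‖Ψ(g - f_n)x‖² ≤ 4 ∫ (g - f_n)² dμ_x.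
      have h2 := hΨ _ (hg.sub (hf n)) x 0
      have h3 : Ψ (g - f n) = Ψ g - Ψ (f n) := by
        have := hadd hg ((hf n).smul (-1))
        rwa [hsmul _ (hf n), neg_one_smul, neg_one_smul, ← sub_eq_add_neg, ← sub_eq_add_neg] at this
      rw [h3] at h2
      rw [norm_sub_rev]
      simpa using h2
    simpa using h1.sqrt
  refine ⟨Ψ, ⟨(hconst 1).trans (one_smul ℝ _), hadd, ?_, hsmul, ?_, ?_⟩, fun j => ?_⟩
  · intro f g hf hg
    ext x
    obtain ⟨C, hC⟩ := hf.2
    obtain ⟨q, hq⟩ := exists_L2Approx (hμ x) hg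
    have h1 : Tendsto (fun n => Ψ (f * fun z => MvPolynomial.eval z (q n)) x) atTop
        (𝓝 (Ψ (f * g) x)) := by
      refine htendsto x (fun n => hf.mul (.polynomial _)) (hf.mul hg) ?_
      refine squeeze_zero (fun n => integral_nonneg fun z => sq_nonneg _) (fun n => ?_)
        (by simpa using Tendsto.const_mul (C ^ 2) hq)
      exact integral_sq_mul_le (hμ x) hf hC hg (BddOnBox.polynomial (q n))
    refine tendsto_nhds_unique h1 ?_
    -- Commutation moves the polynomials q_n onto x, where their convergence to Ψ(g)x is known.
    simp_rw [fun n => hmulpoly (q n) hf x, ← fun n => hcommpoly (q n) hf x]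
    exact ((Ψ f).continuous.tendsto _).comp ((hΨ _ hg x).tendsto hq)
  · intro f hf
    rw [ContinuousLinearMap.isSelfAdjoint_iff_isSymmetric]
    intro x y
    obtain ⟨p, h1, h2⟩ := exists_L2Approx₂ (hμ x) (hμ y) hf
    refine tendsto_nhds_unique (((hΨ _ hf x).tendsto h1).inner (𝕜 := ℝ) tendsto_const_nhds) ?_
    refine (tendsto_const_nhds.inner (𝕜 := ℝ) ((hΨ _ hf y).tendsto h2)).congr fun n => ?_
    exact ((polynomial_isSelfAdjoint π hsa (p n)).isSymmetric x y).symm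
  · intro f g C hfm hgm hC hlim x
    exact htendsto x (fun n => ⟨hfm n, C, hC n⟩) (.of_tendsto hgm hC hlim)
      (tendsto_integral_sq_sub (hμ x) hfm hgm hC hlim)
  · simpa using hpoly (MvPolynomial.X j)

end BoxCalculus

/-! ### Graphs of partial operators -/

section PartialOperators

variable {H : Type*} [NormedAddCommGroup H] [InnerProductSpace ℝ H]

theorem mk_mem_graph_iff (F : H →ₗ.[ℝ] H) (x y : H) :
    (x, y) ∈ F.graph ↔ ∃ h : x ∈ F.domain, F ⟨x, h⟩ = y := by
  rw [LinearPMap.mem_graph_iff]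
  constructor
  · rintro ⟨z, rfl, h⟩
    exact ⟨z.2, h⟩
  · rintro ⟨h, h'⟩
    exact ⟨⟨x, h⟩, rfl, h'⟩

theorem graph_unique {F : H →ₗ.[ℝ] H} {x y z : H} (hy : (x, y) ∈ F.graph) (hz : (x, z) ∈ F.graph) :
    y = z := by
  rw [mk_mem_graph_iff] at hy hz
  exact hy.2.symm.trans hz.2

theorem mem_graph_comp_iff (F G : H →ₗ.[ℝ] H) (x z : H) :
    (x, z) ∈ (comp F G).graph ↔ ∃ y, (x, y) ∈ G.graph ∧ (y, z) ∈ F.graph := by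
  simp only [mk_mem_graph_iff]
  constructor
  · rintro ⟨h, rfl⟩
    obtain ⟨h1, h2⟩ := (mem_comp_domain F G x).1 h
    exact ⟨_, ⟨h1, rfl⟩, h2, rfl⟩
  · rintro ⟨_, ⟨h1, rfl⟩, h2, rfl⟩
    exact ⟨(mem_comp_domain F G x).2 ⟨h1, h2⟩, rfl⟩

theorem mem_graph_add_iff (F G : H →ₗ.[ℝ] H) (x w : H) :
    (x, w) ∈ (F + G).graph ↔ ∃ y z, (x, y) ∈ F.graph ∧ (x, z) ∈ G.graph ∧ y + z = w := by
  simp only [mk_mem_graph_iff]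
  constructor
  · rintro ⟨h, rfl⟩
    exact ⟨_, _, ⟨h.1, rfl⟩, ⟨h.2, rfl⟩, rfl⟩
  · rintro ⟨_, _, ⟨h1, rfl⟩, ⟨h2, rfl⟩, rfl⟩
    exact ⟨⟨h1, h2⟩, rfl⟩

theorem mem_graph_smul_iff (c : ℝ) (F : H →ₗ.[ℝ] H) (x w : H) :
    (x, w) ∈ (c • F).graph ↔ ∃ y, (x, y) ∈ F.graph ∧ c • y = w := by
  simp only [mk_mem_graph_iff]
  constructor
  · rintro ⟨h, rfl⟩
    exact ⟨_, ⟨h, rfl⟩, rfl⟩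
  · rintro ⟨_, ⟨h, rfl⟩, rfl⟩
    exact ⟨h, rfl⟩

theorem mem_graph_ofBounded_iff (T : H →L[ℝ] H) (x y : H) :
    (x, y) ∈ (ofBounded T).graph ↔ T x = y := by
  rw [mk_mem_graph_iff]
  exact ⟨fun h => h.2, fun h => ⟨trivial, h⟩⟩

theorem eq_ofBounded_of_graph {F : H →ₗ.[ℝ] H} {T : H →L[ℝ] H} (h : ∀ x, (x, T x) ∈ F.graph) :
    F = ofBounded T := by
  refine LinearPMap.eq_of_eq_graph (Submodule.ext fun ⟨x, y⟩ => ?_)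
  rw [mem_graph_ofBounded_iff]
  constructor
  · exact fun hy => graph_unique (h x) hy
  · rintro rfl
    exact h x

theorem ofBounded_injective {T S : H →L[ℝ] H} (h : ofBounded T = ofBounded S) : T = S := by
  ext x
  have h1 : (x, T x) ∈ (ofBounded S).graph := h ▸ (mem_graph_ofBounded_iff T x _).2 rfl
  exact ((mem_graph_ofBounded_iff S x _).1 h1).symm

end PartialOperators

/-! ### Extension to unbounded functions by regularization -/

section UnboundedExtension

variable {H : Type*} [NormedAddCommGroup H] [InnerProductSpace ℝ H] [CompleteSpace H] {d : ℕ}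
  {R : ℝ} {Ψ : ((Fin d → ℝ) → ℝ) → H →L[ℝ] H}

/-- A positive function `e` such that `e` and `e * f` are bounded on the cube. -/
structure IsRegularizer (R : ℝ) (e f : (Fin d → ℝ) → ℝ) : Prop where
  pos : ∀ z, 0 < e z
  bdd : BddOnBox R e
  bdd_mul : BddOnBox R (e * f)

/-- The function `1 / (1 + |f|)`. -/
noncomputable def regularizer (f : (Fin d → ℝ) → ℝ) : (Fin d → ℝ) → ℝ := fun z => (1 + |f z|)⁻¹

theorem regularizer_pos (f : (Fin d → ℝ) → ℝ) (z : Fin d → ℝ) : 0 < regularizer f z := by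
  unfold regularizer; positivity

theorem measurable_regularizer {f : (Fin d → ℝ) → ℝ} (hf : Measurable f) :
    Measurable (regularizer f) := by
  unfold regularizer
  exact (measurable_const.add hf.norm).inv

theorem abs_regularizer_le (f : (Fin d → ℝ) → ℝ) (z : Fin d → ℝ) : |regularizer f z| ≤ 1 := by
  rw [abs_of_pos (regularizer_pos f z)]
  exact inv_le_one_of_one_le₀ (by linarith [abs_nonneg (f z)])

theorem abs_regularizer_mul_le (f : (Fin d → ℝ) → ℝ) (z : Fin d → ℝ) :
    |regularizer f z * f z| ≤ 1 := by
  rw [abs_mul, abs_of_pos (regularizer_pos f z), regularizer, inv_mul_le_one₀ (by positivity)]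
  linarith

theorem isRegularizer_regularizer {f : (Fin d → ℝ) → ℝ} (hf : Measurable f) :
    IsRegularizer R (regularizer f) f :=
  ⟨regularizer_pos f, .of_abs_le (measurable_regularizer hf) (abs_regularizer_le f),
    .of_abs_le ((measurable_regularizer hf).mul hf) (abs_regularizer_mul_le f)⟩

theorem IsRegularizer.mul_right {e f e' : (Fin d → ℝ) → ℝ} (h : IsRegularizer R e f)
    (hpos : ∀ z, 0 < e' z) (hb : BddOnBox R e') : IsRegularizer R (e * e') f :=
  ⟨fun z => mul_pos (h.pos z) (hpos z), h.bdd.mul hb, by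
    rw [mul_right_comm]; exact h.bdd_mul.mul hb⟩

namespace IsBoxCalculus

/-- The functions min(n, 1/e) are bounded and their products with e tend boundedly to 1, so they
recover y from Ψ(e)y in the limit. -/
theorem injective_of_pos (hΨ : IsBoxCalculus R Ψ) {e : (Fin d → ℝ) → ℝ} (he : BddOnBox R e)
    (hpos : ∀ z, 0 < e z) {y : H} (h : Ψ e y = 0) : y = 0 := by
  have hg : ∀ n : ℕ, BddOnBox R (fun z => min (n : ℝ) (e z)⁻¹) := fun n =>
    .of_abs_le (C := n) (measurable_const.min he.1.inv) fun z => by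
      have := hpos z
      rw [abs_of_nonneg (by positivity)]
      exact min_le_left _ _
  have hlim := hΨ.tendsto (f := fun n : ℕ => (fun z => min (n : ℝ) (e z)⁻¹) * e) (g := 1) (C := 1)
    (fun n => ((hg n).mul he).1) measurable_const (fun n z _ => by
      have := hpos z
      rw [Pi.mul_apply, abs_of_nonneg (by positivity), ← inv_mul_cancel₀ this.ne']
      gcongr
      exact min_le_right _ _) (fun z _ => by
      refine tendsto_const_nhds.congr' ?_
      obtain ⟨N, hN⟩ := exists_nat_ge (e z)⁻¹
      filter_upwards [eventually_ge_atTop N] with n hn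
      rw [Pi.mul_apply, min_eq_right (hN.trans (by exact_mod_cast hn)),
        inv_mul_cancel₀ (hpos z).ne', Pi.one_apply]) y
  simp_rw [fun n => hΨ.map_mul (hg n) he, mul_apply_eq_comp, h, map_zero, hΨ.map_one,
    one_apply_eq_self] at hlim
  exact (tendsto_nhds_unique hlim tendsto_const_nhds)

theorem mul_apply (hΨ : IsBoxCalculus R Ψ) {f g : (Fin d → ℝ) → ℝ} (hf : BddOnBox R f)
    (hg : BddOnBox R g) (x : H) : Ψ f (Ψ g x) = Ψ (f * g) x := by
  rw [hΨ.map_mul hf hg, mul_apply_eq_comp]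

/-- Apply the injective Ψ(e) to Ψ(e')y - Ψ(e'f)x and commute. Hence the graph of Φ(f) does not
depend on the regularizer, and each law can be checked with a convenient one. -/
theorem regularizer_imp (hΨ : IsBoxCalculus R Ψ) {e e' f : (Fin d → ℝ) → ℝ}
    (he : IsRegularizer R e f) (he' : IsRegularizer R e' f) {x y : H}
    (h : Ψ e y = Ψ (e * f) x) : Ψ e' y = Ψ (e' * f) x := by
  refine sub_eq_zero.1 (hΨ.injective_of_pos he.bdd he.pos ?_)
  rw [map_sub, hΨ.mul_apply he.bdd he'.bdd, hΨ.mul_apply he.bdd he'.bdd_mul, mul_comm e e',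
    ← hΨ.mul_apply he'.bdd he.bdd, h, hΨ.mul_apply he'.bdd he.bdd_mul, mul_left_comm, sub_self]

variable (Ψ) in
/-- The partial operator with graph `{(x, y) | Ψ e y = Ψ (e f) x}`, where `e = 1 / (1 + |f|)`. -/
noncomputable def extend (f : (Fin d → ℝ) → ℝ) : H →ₗ.[ℝ] H :=
  (LinearMap.ker (((Ψ (regularizer f)).comp (ContinuousLinearMap.snd ℝ H H) -
    (Ψ (regularizer f * f)).comp (ContinuousLinearMap.fst ℝ H H) :
      H × H →L[ℝ] H) : H × H →ₗ[ℝ] H)).toLinearPMap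

/-- Single-valuedness is what has to be checked: (0, y) in the kernel means Ψ(e)y = 0, hence y = 0.
-/
theorem graph_extend (hΨ : IsBoxCalculus R Ψ) {f : (Fin d → ℝ) → ℝ} (hf : Measurable f) :
    (extend Ψ f).graph = LinearMap.ker (((Ψ (regularizer f)).comp (ContinuousLinearMap.snd ℝ H H) -
    (Ψ (regularizer f * f)).comp (ContinuousLinearMap.fst ℝ H H) :
      H × H →L[ℝ] H) : H × H →ₗ[ℝ] H) := by
  refine Submodule.toLinearPMap_graph_eq _ ?_
  rintro ⟨x, y⟩ hxy (rfl : x = 0)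
  have hr := isRegularizer_regularizer (R := R) hf
  refine hΨ.injective_of_pos hr.bdd hr.pos ?_
  simpa using hxy

theorem mem_graph_extend_iff (hΨ : IsBoxCalculus R Ψ) {f e : (Fin d → ℝ) → ℝ} (hf : Measurable f)
    (he : IsRegularizer R e f) {x y : H} :
    (x, y) ∈ (extend Ψ f).graph ↔ Ψ e y = Ψ (e * f) x := by
  have : (x, y) ∈ (extend Ψ f).graph ↔ Ψ (regularizer f) y = Ψ (regularizer f * f) x := by
    rw [hΨ.graph_extend hf]
    simp [sub_eq_zero]
  rw [this]
  exact ⟨hΨ.regularizer_imp (isRegularizer_regularizer hf) he,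
    hΨ.regularizer_imp he (isRegularizer_regularizer hf)⟩

theorem extend_isClosed (hΨ : IsBoxCalculus R Ψ) {f : (Fin d → ℝ) → ℝ} (hf : Measurable f) :
    (extend Ψ f).IsClosed := by
  rw [LinearPMap.IsClosed, hΨ.graph_extend hf]
  exact ContinuousLinearMap.isClosed_ker _

theorem extend_of_bddOnBox (hΨ : IsBoxCalculus R Ψ) {f : (Fin d → ℝ) → ℝ} (hf : BddOnBox R f) :
    extend Ψ f = ofBounded (Ψ f) := by
  refine eq_ofBounded_of_graph fun x => ?_
  have h1 : IsRegularizer R 1 f := ⟨fun _ => one_pos, .const 1, by rwa [one_mul]⟩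
  rw [hΨ.mem_graph_extend_iff hf.1 h1, hΨ.map_one, one_mul, one_apply_eq_self]

/-- With the regularizers e_f, e_g of f and g, Ψ(e_f e_g f)y = Ψ(e_f f)Ψ(e_g g)x = Ψ(e_f e_g f g)x.
This one equivalence yields both the product inclusion and the domain law. -/
theorem mem_graph_extend_mul_iff (hΨ : IsBoxCalculus R Ψ) {f g : (Fin d → ℝ) → ℝ}
    (hf : Measurable f) (hg : Measurable g) {x y z : H} (hy : (x, y) ∈ (extend Ψ g).graph) :
    (y, z) ∈ (extend Ψ f).graph ↔ (x, z) ∈ (extend Ψ (f * g)).graph := by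
  have rf := isRegularizer_regularizer (R := R) hf
  have rg := isRegularizer_regularizer (R := R) hg
  have rf' := rf.mul_right rg.pos rg.bdd
  have rfg : IsRegularizer R (regularizer f * regularizer g) (f * g) :=
    ⟨rf'.pos, rf'.bdd, by rw [mul_mul_mul_comm]; exact rf.bdd_mul.mul rg.bdd_mul⟩
  rw [hΨ.mem_graph_extend_iff hf rf', hΨ.mem_graph_extend_iff (hf.mul hg) rfg]
  rw [hΨ.mem_graph_extend_iff hg rg] at hy
  rw [mul_right_comm, ← hΨ.mul_apply rf.bdd_mul rg.bdd, hy, hΨ.mul_apply rf.bdd_mul rg.bdd_mul,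
    mul_mul_mul_comm]

/-- The measurable calculus generated by a box calculus. -/
noncomputable def toMeasurableCalculus (hΨ : IsBoxCalculus R Ψ) :
    MeasurableCalculus ℝ (Fin d → ℝ) H where
  toFun f := extend Ψ f.1
  isClosed f := hΨ.extend_isClosed f.2
  map_one := (hΨ.extend_of_bddOnBox (.const 1)).trans (congrArg ofBounded hΨ.map_one)
  add_le f g := by
    rw [← LinearPMap.le_graph_iff]
    rintro ⟨x, w⟩ h
    obtain ⟨y, z, hy, hz, rfl⟩ := (mem_graph_add_iff _ _ _ _).1 h
    have hf := isRegularizer_regularizer (R := R) f.2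
    have hg := isRegularizer_regularizer (R := R) g.2
    have hf' := hf.mul_right hg.pos hg.bdd
    have hg' := hg.mul_right hf.pos hf.bdd
    rw [mul_comm] at hg'
    rw [hΨ.mem_graph_extend_iff f.2 hf'] at hy
    rw [hΨ.mem_graph_extend_iff g.2 hg'] at hz
    have hfg : IsRegularizer R (regularizer f.1 * regularizer g.1) (f + g).1 :=
      ⟨hf'.pos, hf'.bdd, by
        have := hf'.bdd_mul.add hg'.bdd_mul
        rwa [← mul_add] at this⟩
    rw [hΨ.mem_graph_extend_iff (f + g).2 hfg, _root_.map_add, hy, hz]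
    have := congrArg (fun T : H →L[ℝ] H => T x) (hΨ.map_add hf'.bdd_mul hg'.bdd_mul)
    rw [← mul_add] at this
    exact this.symm
  smul_le c f := by
    rw [← LinearPMap.le_graph_iff]
    rintro ⟨x, w⟩ h
    obtain ⟨y, hy, rfl⟩ := (mem_graph_smul_iff _ _ _ _).1 h
    have hf := isRegularizer_regularizer (R := R) f.2
    rw [hΨ.mem_graph_extend_iff f.2 hf] at hy
    have hcf : IsRegularizer R (regularizer f.1) (c • f).1 :=
      ⟨hf.pos, hf.bdd, by
        have := hf.bdd_mul.smul c
        rwa [← mul_smul_comm] at this⟩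
    rw [hΨ.mem_graph_extend_iff (c • f).2 hcf, _root_.map_smul, hy]
    have := congrArg (fun T : H →L[ℝ] H => T x) (hΨ.map_smul c hf.bdd_mul)
    rw [← mul_smul_comm] at this
    exact this.symm
  comp_le f g := by
    rw [← LinearPMap.le_graph_iff]
    rintro ⟨x, z⟩ h
    obtain ⟨y, hy, hz⟩ := (mem_graph_comp_iff _ _ _ _).1 h
    exact (hΨ.mem_graph_extend_mul_iff f.2 g.2 hy).1 hz
  domain_comp f g := by
    ext x
    simp only [Submodule.mem_inf, LinearPMap.mem_domain_iff, mem_graph_comp_iff]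
    constructor
    · rintro ⟨z, y, hy, hz⟩
      exact ⟨⟨y, hy⟩, z, (hΨ.mem_graph_extend_mul_iff f.2 g.2 hy).1 hz⟩
    · rintro ⟨⟨y, hy⟩, z, hz⟩
      exact ⟨z, y, hy, (hΨ.mem_graph_extend_mul_iff f.2 g.2 hy).2 hz⟩
  bounded f := by
    rintro ⟨C, hC⟩
    have hf : BddOnBox R f.1 := .of_abs_le f.2 hC
    refine ⟨Ψ f.1, hΨ.extend_of_bddOnBox hf, ?_⟩
    rw [(hΨ.isSelfAdjoint hf).adjoint_eq, ← hΨ.extend_of_bddOnBox hf]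
    exact congrArg (extend Ψ) (star_trivial f.1)
  weak_bp_continuous f g := by
    rintro ⟨C, hC⟩ hlim T S hT hS x y
    have hf : ∀ n, BddOnBox R (f n).1 := fun n => .of_abs_le (f n).2 (hC n)
    have hg : BddOnBox R g.1 := .of_tendsto g.2 (fun n z _ => hC n z) fun z _ => hlim z
    have hT' : ∀ n, T n = Ψ (f n).1 := fun n =>
      ofBounded_injective ((hT n).symm.trans (hΨ.extend_of_bddOnBox (hf n)))
    have hS' : S = Ψ g.1 := ofBounded_injective (hS.symm.trans (hΨ.extend_of_bddOnBox hg))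
    simp_rw [hT', hS']
    exact tendsto_const_nhds.inner (hΨ.tendsto (fun n => (f n).2) g.2 (fun n z _ => hC n z)
      (fun z _ => hlim z) x)

end IsBoxCalculus

end UnboundedExtension

/-! ### Consequences of the axioms of a calculus -/

namespace MeasurableCalculus

variable {H : Type*} [NormedAddCommGroup H] [InnerProductSpace ℝ H] [CompleteSpace H]

section General

variable {X : Type*} [MeasurableSpace X] (Φ : MeasurableCalculus ℝ X H)
  {f g : MeasurableFunctions ℝ X}

theorem mem_graph_add {x y z : H} (hy : (x, y) ∈ (Φ.toFun f).graph)
    (hz : (x, z) ∈ (Φ.toFun g).graph) : (x, y + z) ∈ (Φ.toFun (f + g)).graph :=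
  LinearPMap.le_graph_of_le (Φ.add_le f g)
    ((mem_graph_add_iff _ _ _ _).2 ⟨y, z, hy, hz, rfl⟩)

theorem mem_graph_smul (c : ℝ) {x y : H} (hy : (x, y) ∈ (Φ.toFun f).graph) :
    (x, c • y) ∈ (Φ.toFun (c • f)).graph :=
  LinearPMap.le_graph_of_le (Φ.smul_le c f) ((mem_graph_smul_iff _ _ _ _).2 ⟨y, hy, rfl⟩)

theorem mem_graph_mul {x y z : H} (hy : (x, y) ∈ (Φ.toFun g).graph)
    (hz : (y, z) ∈ (Φ.toFun f).graph) : (x, z) ∈ (Φ.toFun (f * g)).graph :=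
  LinearPMap.le_graph_of_le (Φ.comp_le f g) ((mem_graph_comp_iff _ _ _ _).2 ⟨y, hy, hz⟩)

/-- The domain law puts x in the domain of Φ(f)Φ(g), and single-valuedness identifies the values.
This cancellation is how the domain law enters uniqueness. -/
theorem mem_graph_of_mul {x y z : H} (hy : (x, y) ∈ (Φ.toFun g).graph)
    (hz : (x, z) ∈ (Φ.toFun (f * g)).graph) : (y, z) ∈ (Φ.toFun f).graph := by
  have hx : x ∈ (comp (Φ.toFun f) (Φ.toFun g)).domain := by
    rw [Φ.domain_comp]
    exact ⟨LinearPMap.mem_domain_iff.2 ⟨y, hy⟩, LinearPMap.mem_domain_iff.2 ⟨z, hz⟩⟩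
  obtain ⟨w, hw⟩ := LinearPMap.mem_domain_iff.1 hx
  obtain ⟨y', hy', hw'⟩ := (mem_graph_comp_iff _ _ _ _).1 hw
  obtain rfl := graph_unique hy hy'
  obtain rfl := graph_unique hz (Φ.mem_graph_mul hy' hw')
  exact hw'

theorem mem_graph_of_eq {T : H →L[ℝ] H} (h : Φ.toFun f = ofBounded T) (x : H) :
    (x, T x) ∈ (Φ.toFun f).graph := by
  rw [h, mem_graph_ofBounded_iff]

variable {Φ} {T S : H →L[ℝ] H}

theorem map_one' : Φ.toFun 1 = ofBounded 1 := Φ.map_one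

theorem map_add (hf : Φ.toFun f = ofBounded T) (hg : Φ.toFun g = ofBounded S) :
    Φ.toFun (f + g) = ofBounded (T + S) :=
  eq_ofBounded_of_graph fun x => Φ.mem_graph_add (Φ.mem_graph_of_eq hf x) (Φ.mem_graph_of_eq hg x)

theorem map_smul (c : ℝ) (hf : Φ.toFun f = ofBounded T) :
    Φ.toFun (c • f) = ofBounded (c • T) :=
  eq_ofBounded_of_graph fun x => Φ.mem_graph_smul c (Φ.mem_graph_of_eq hf x)

theorem map_mul (hf : Φ.toFun f = ofBounded T) (hg : Φ.toFun g = ofBounded S) :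
    Φ.toFun (f * g) = ofBounded (T * S) :=
  eq_ofBounded_of_graph fun x =>
    Φ.mem_graph_mul (Φ.mem_graph_of_eq hg x) (Φ.mem_graph_of_eq hf (S x))

variable (Φ) in
theorem exists_bounded {C : ℝ} (hC : ∀ x, |f.1 x| ≤ C) :
    ∃ T : H →L[ℝ] H, Φ.toFun f = ofBounded T ∧ IsSelfAdjoint T := by
  obtain ⟨T, h1, h2⟩ := Φ.bounded f ⟨C, hC⟩
  refine ⟨T, h1, ?_⟩
  have : star f = f := Subtype.ext (star_trivial f.1)
  rw [this, h1] at h2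
  exact (ofBounded_injective h2).symm

/-- The graph of `Φ(f)` is determined by `Φ` on bounded functions. -/
theorem mem_graph_iff {e h : MeasurableFunctions ℝ X} (he : h * e = 1) {E F : H →L[ℝ] H}
    (hE : Φ.toFun e = ofBounded E) (hF : Φ.toFun (e * f) = ofBounded F) {x y : H} :
    (x, y) ∈ (Φ.toFun f).graph ↔ E y = F x := by
  constructor
  · intro hxy
    exact graph_unique (Φ.mem_graph_mul hxy (Φ.mem_graph_of_eq hE y)) (Φ.mem_graph_of_eq hF x)
  · intro hxy
    -- Φ(h) inverts E because h = 1/e; applying it after F gives a pair in the graph of Φ(hef) =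
    -- Φ(f).
    have h1 : (E y, y) ∈ (Φ.toFun h).graph :=
      Φ.mem_graph_of_mul (Φ.mem_graph_of_eq hE y) (by
        rw [he]; exact Φ.mem_graph_of_eq map_one' y)
    rw [hxy] at h1
    have h2 := Φ.mem_graph_mul (Φ.mem_graph_of_eq hF x) h1
    rwa [← mul_assoc, he, one_mul] at h2

/-- If `Φ(f)` is bounded with norm less than `R`, then `Φ` vanishes on the indicator function of
`{R < |f|}`. -/
theorem map_indicator_eq_zero {A : H →L[ℝ] H} (hf : Φ.toFun f = ofBounded A) {R : ℝ}
    (hA : ‖A‖ < R) {k : MeasurableFunctions ℝ X}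
    (hk : k.1 = {x | R < |f.1 x|}.indicator fun _ => 1) : Φ.toFun k = ofBounded 0 := by
  have hR : 0 < R := (norm_nonneg _).trans_lt hA
  have hB : MeasurableSet {x | R < |f.1 x|} :=
    measurableSet_lt measurable_const (measurable_norm.comp f.2)
  let h : MeasurableFunctions ℝ X :=
    ⟨{x | R < |f.1 x|}.indicator fun x => (f.1 x)⁻¹, Measurable.indicator (Measurable.inv f.2) hB⟩
  -- Here h is 1/f on {R < |f|}, and m is chosen so that m² + R²h² = k². This turns the inequality
  -- R²h² ≤ k² into an identity the calculus preserves.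
  let m : MeasurableFunctions ℝ X :=
    ⟨{x | R < |f.1 x|}.indicator fun x => √(1 - R ^ 2 * ((f.1 x)⁻¹) ^ 2),
      Measurable.indicator (Measurable.sqrt (measurable_const.sub
        (measurable_const.mul ((Measurable.inv f.2).pow_const 2)))) hB⟩
  have hsq : ∀ x, R < |f.1 x| → R ^ 2 * ((f.1 x)⁻¹) ^ 2 ≤ 1 := by
    intro x hx
    rw [inv_pow, ← div_eq_mul_inv, ← sq_abs (f.1 x)]
    exact div_le_one_of_le₀ (by gcongr) (by positivity)
  obtain ⟨S, hS, hSsa⟩ := Φ.exists_bounded (f := h) (C := R⁻¹) fun x => by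
    by_cases hx : R < |f.1 x|
    · have : h.1 x = (f.1 x)⁻¹ :=
        Set.indicator_of_mem (s := {x | R < |f.1 x|}) hx (fun x => (f.1 x)⁻¹)
      rw [this, abs_inv]
      gcongr
    · have : h.1 x = 0 :=
        Set.indicator_of_notMem (s := {x | R < |f.1 x|}) hx (fun x => (f.1 x)⁻¹)
      rw [this, abs_zero]
      positivity
  obtain ⟨M, hM, hMsa⟩ := Φ.exists_bounded (f := m) (C := 1) fun x => by
    by_cases hx : R < |f.1 x|
    · have : m.1 x = √(1 - R ^ 2 * ((f.1 x)⁻¹) ^ 2) :=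
        Set.indicator_of_mem (s := {x | R < |f.1 x|}) hx
          (fun x => √(1 - R ^ 2 * ((f.1 x)⁻¹) ^ 2))
      rw [this, abs_of_nonneg (Real.sqrt_nonneg _)]
      refine Real.sqrt_le_one.2 ?_
      have : 0 ≤ R ^ 2 * ((f.1 x)⁻¹) ^ 2 := by positivity
      linarith
    · have : m.1 x = 0 := Set.indicator_of_notMem (s := {x | R < |f.1 x|}) hx
        (fun x => √(1 - R ^ 2 * ((f.1 x)⁻¹) ^ 2))
      rw [this, abs_zero]
      positivity
  obtain ⟨T, hT, hTsa⟩ := Φ.exists_bounded (f := k) (C := 1) fun x => by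
    rw [hk]
    by_cases hx : R < |f.1 x| <;> simp [hx]
  have e1 : f * h = k := by
    refine Subtype.ext (funext fun x => ?_)
    rw [hk]
    change f.1 x * {x | R < |f.1 x|}.indicator (fun x => (f.1 x)⁻¹) x = _
    by_cases hx : R < |f.1 x|
    · have : f.1 x ≠ 0 := fun h0 => by rw [h0, abs_zero] at hx; linarith
      simp [hx, this]
    · simp [hx]
  have e2 : m * m + R ^ 2 • (h * h) = k * k := by
    refine Subtype.ext (funext fun x => ?_)
    change m.1 x * m.1 x + R ^ 2 * (h.1 x * h.1 x) = k.1 x * k.1 x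
    rw [hk]
    simp only [m, h]
    by_cases hx : R < |f.1 x|
    · rw [Set.indicator_of_mem (by exact hx), Set.indicator_of_mem (by exact hx),
        Set.indicator_of_mem (by exact hx), Real.mul_self_sqrt (by linarith [hsq x hx])]
      ring
    · rw [Set.indicator_of_notMem (by exact hx), Set.indicator_of_notMem (by exact hx),
        Set.indicator_of_notMem (by exact hx)]
      ring
  have hTS : T = A * S := ofBounded_injective (hT.symm.trans (e1 ▸ map_mul hf hS))
  have hMST : M * M + R ^ 2 • (S * S) = T * T := ofBounded_injective
    ((map_add (map_mul hM hM) (map_smul (R ^ 2) (map_mul hS hS))).symm.trans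
      (e2 ▸ map_mul hT hT))
  -- R‖Sx‖ ≤ ‖Tx‖ = ‖ASx‖ ≤ ‖A‖‖Sx‖ with ‖A‖ < R forces Sx = 0.
  have hS0 : S = 0 := by
    ext x
    have h1 := congrArg (fun V : H →L[ℝ] H => ⟪V x, x⟫_ℝ) hMST
    simp only [_root_.add_apply, _root_.smul_apply, inner_add_left, real_inner_smul_left,
      inner_sq_apply hMsa, inner_sq_apply hSsa, inner_sq_apply hTsa] at h1
    have h2 : ‖T x‖ ≤ ‖A‖ * ‖S x‖ := by
      rw [hTS]; exact A.le_opNorm (S x)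
    have h3 : (R * ‖S x‖) ^ 2 ≤ (‖A‖ * ‖S x‖) ^ 2 := by
      have : ‖T x‖ ^ 2 ≤ (‖A‖ * ‖S x‖) ^ 2 := by gcongr
      nlinarith [sq_nonneg ‖M x‖]
    have h4 := le_of_sq_le_sq h3 (by positivity)
    have h5 : ‖S x‖ ≤ 0 := by
      by_contra h6
      push Not at h6
      exact absurd h4 (not_le.2 (by gcongr))
    simpa using h5
  rw [hT, hTS, hS0, mul_zero]

end General

/-! ### Uniqueness of the calculus -/

section Uniqueness

variable {d : ℕ} {R : ℝ} {Φ Φ' : MeasurableCalculus ℝ (Fin d → ℝ) H} {A : Fin d → (H →L[ℝ] H)}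

/-- The indicator function of the cube `[-R, R]^d`. -/
noncomputable def boxIndicator (d : ℕ) (R : ℝ) : MeasurableFunctions ℝ (Fin d → ℝ) :=
  ⟨(box d R).indicator fun _ => 1, measurable_const.indicator (measurableSet_box d R)⟩

theorem boxIndicator_apply_mem {z : Fin d → ℝ} (hz : z ∈ box d R) : (boxIndicator d R).1 z = 1 :=
  Set.indicator_of_mem hz (fun _ => (1 : ℝ))

theorem boxIndicator_apply_notMem {z : Fin d → ℝ} (hz : z ∉ box d R) :
    (boxIndicator d R).1 z = 0 :=
  Set.indicator_of_notMem hz (fun _ => (1 : ℝ))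

theorem boxIndicator_mul_self : boxIndicator d R * boxIndicator d R = boxIndicator d R := by
  refine Subtype.ext (funext fun z => ?_)
  change (boxIndicator d R).1 z * (boxIndicator d R).1 z = (boxIndicator d R).1 z
  by_cases hz : z ∈ box d R
  · rw [boxIndicator_apply_mem hz, one_mul]
  · rw [boxIndicator_apply_notMem hz, zero_mul]

/-- The indicator of the cube is the product of the functions 1 - k_j, where k_j is the indicator of
{R < |z_j|}, and Φ(k_j) = 0. -/
theorem map_boxIndicator (hΦ : ∀ j, Φ.toFun (coord ℝ j) = ofBounded (A j))
    (hA : ∀ j, ‖A j‖ < R) : Φ.toFun (boxIndicator d R) = ofBounded 1 := by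
  let k : Fin d → MeasurableFunctions ℝ (Fin d → ℝ) := fun j =>
    ⟨{z | R < |z j|}.indicator fun _ => 1, measurable_const.indicator
      (measurableSet_lt measurable_const (measurable_norm.comp (measurable_pi_apply j)))⟩
  have hk : ∀ j, Φ.toFun (k j) = ofBounded 0 := fun j =>
    map_indicator_eq_zero (hΦ j) (hA j) rfl
  have hprod := Finset.prod_induction (s := Finset.univ) (fun j => 1 + (-1 : ℝ) • k j)
    (fun f => Φ.toFun f = ofBounded 1)
    (fun f g hf hg => by simpa using map_mul hf hg) map_one'
    (fun j _ => by simpa using map_add (Φ := Φ) map_one' (map_smul (-1) (hk j)))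
  convert hprod using 2
  refine Subtype.ext (funext fun z => ?_)
  have e1 : (∏ j, (1 + (-1 : ℝ) • k j)).1 z = ∏ j, (1 + (-1 : ℝ) * (k j).1 z) := by
    have h := congrFun (map_prod (MeasurableFunctions ℝ (Fin d → ℝ)).subtype
      (fun j => 1 + (-1 : ℝ) • k j) Finset.univ) z
    rw [Finset.prod_apply] at h
    exact h
  rw [e1]
  by_cases hz : z ∈ box d R
  · rw [boxIndicator_apply_mem hz, Finset.prod_eq_one]
    intro j _
    have : (k j).1 z = 0 := Set.indicator_of_notMem (s := {z : Fin d → ℝ | R < |z j|})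
      (not_lt.2 (hz j)) (fun _ => (1 : ℝ))
    rw [this]; ring
  · rw [boxIndicator_apply_notMem hz]
    have : ∃ j, R < |z j| := by
      by_contra h
      push Not at h
      exact hz h
    obtain ⟨j, hj⟩ := this
    refine (Finset.prod_eq_zero (Finset.mem_univ j) ?_).symm
    have : (k j).1 z = 1 := Set.indicator_of_mem (s := {z : Fin d → ℝ | R < |z j|}) hj
      (fun _ => (1 : ℝ))
    rw [this]; ring

/-- The factor `boxIndicator` makes f bounded everywhere without changing it on the cube, so the
weak continuity axiom applies to limits taken only there; weak limits are unique. -/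
theorem eq_on_box (hR : ∀ j, ‖A j‖ < R) (hΦ : ∀ j, Φ.toFun (coord ℝ j) = ofBounded (A j))
    (hΦ' : ∀ j, Φ'.toFun (coord ℝ j) = ofBounded (A j)) {f : (Fin d → ℝ) → ℝ}
    (hf : BddOnBox R f) : ∃ T : H →L[ℝ] H,
      Φ.toFun (boxIndicator d R * ⟨f, hf.1⟩) = ofBounded T ∧
      Φ'.toFun (boxIndicator d R * ⟨f, hf.1⟩) = ofBounded T := by
  have h1 := map_boxIndicator hΦ hR
  have h1' := map_boxIndicator hΦ' hR
  refine borel_induction (R := R) (fun f => ∀ hf : Measurable f, ∃ T : H →L[ℝ] H,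
      Φ.toFun (boxIndicator d R * ⟨f, hf⟩) = ofBounded T ∧
      Φ'.toFun (boxIndicator d R * ⟨f, hf⟩) = ofBounded T) ?_ ?_ ?_ ?_ ?_ hf hf.1
  · intro c hc
    have e : boxIndicator d R * ⟨fun _ => c, hc⟩ = c • boxIndicator d R :=
      Subtype.ext (funext fun z => mul_comm _ _)
    rw [e]
    exact ⟨_, map_smul c h1, map_smul c h1'⟩
  · intro j hc
    exact ⟨_, map_mul h1 (hΦ j), map_mul h1' (hΦ' j)⟩
  · intro f g hf hg hPf hPg hfg
    obtain ⟨T, hT, hT'⟩ := hPf hf.1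
    obtain ⟨S, hS, hS'⟩ := hPg hg.1
    have e : boxIndicator d R * ⟨f + g, hfg⟩ =
        boxIndicator d R * ⟨f, hf.1⟩ + boxIndicator d R * ⟨g, hg.1⟩ :=
      Subtype.ext (funext fun z => mul_add _ _ _)
    rw [e]
    exact ⟨_, map_add hT hS, map_add hT' hS'⟩
  · intro f g hf hg hPf hPg hfg
    obtain ⟨T, hT, hT'⟩ := hPf hf.1
    obtain ⟨S, hS, hS'⟩ := hPg hg.1
    have e : boxIndicator d R * ⟨f * g, hfg⟩ =
        (boxIndicator d R * ⟨f, hf.1⟩) * (boxIndicator d R * ⟨g, hg.1⟩) := by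
      rw [mul_mul_mul_comm, boxIndicator_mul_self]
      rfl
    rw [e]
    exact ⟨_, map_mul hT hS, map_mul hT' hS'⟩
  · intro f g C hf hg hC hlim hP hg'
    choose T hT hT' using fun n => hP n (hf n)
    have hbd : ∀ {u : (Fin d → ℝ) → ℝ} (hu : Measurable u), (∀ z ∈ box d R, |u z| ≤ C) →
        ∀ z, |(boxIndicator d R * ⟨u, hu⟩ : MeasurableFunctions ℝ (Fin d → ℝ)).1 z| ≤ |C| := by
      intro u hu h z
      change |(boxIndicator d R).1 z * u z| ≤ |C|
      by_cases hz : z ∈ box d R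
      · rw [boxIndicator_apply_mem hz, one_mul]
        exact (h z hz).trans (le_abs_self C)
      · rw [boxIndicator_apply_notMem hz, zero_mul, abs_zero]
        exact abs_nonneg C
    have hgC : ∀ z ∈ box d R, |g z| ≤ C := fun z hz =>
      le_of_tendsto' (hlim z hz).abs fun n => hC n z hz
    have hpt : ∀ z, Tendsto (fun n => (boxIndicator d R * ⟨f n, hf n⟩ :
        MeasurableFunctions ℝ (Fin d → ℝ)).1 z) atTop
        (𝓝 ((boxIndicator d R * ⟨g, hg'⟩ : MeasurableFunctions ℝ (Fin d → ℝ)).1 z)) := by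
      intro z
      change Tendsto (fun n => (boxIndicator d R).1 z * f n z) atTop
        (𝓝 ((boxIndicator d R).1 z * g z))
      by_cases hz : z ∈ box d R
      · exact (hlim z hz).const_mul _
      · simp_rw [boxIndicator_apply_notMem hz, zero_mul]
        exact tendsto_const_nhds
    obtain ⟨S, hS, -⟩ := Φ.exists_bounded (hbd hg' hgC)
    obtain ⟨S', hS', -⟩ := Φ'.exists_bounded (hbd hg' hgC)
    have heq : S = S' := by
      ext x
      refine ext_inner_left ℝ fun y => ?_
      exact tendsto_nhds_unique
        (Φ.weak_bp_continuous _ _ ⟨|C|, fun n => hbd (hf n) (hC n)⟩ hpt T S hT hS x y)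
        (Φ'.weak_bp_continuous _ _ ⟨|C|, fun n => hbd (hf n) (hC n)⟩ hpt T S' hT' hS' x y)
    exact ⟨S, hS, heq ▸ hS'⟩

theorem eq_of_bounded (hR : ∀ j, ‖A j‖ < R) (hΦ : ∀ j, Φ.toFun (coord ℝ j) = ofBounded (A j))
    (hΦ' : ∀ j, Φ'.toFun (coord ℝ j) = ofBounded (A j))
    {f : MeasurableFunctions ℝ (Fin d → ℝ)} {C : ℝ} (hC : ∀ z, |f.1 z| ≤ C) :
    ∃ T : H →L[ℝ] H, Φ.toFun f = ofBounded T ∧ Φ'.toFun f = ofBounded T := by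
  obtain ⟨T, hT, -⟩ := Φ.exists_bounded hC
  obtain ⟨T', hT', -⟩ := Φ'.exists_bounded hC
  obtain ⟨S, hS, hS'⟩ := eq_on_box hR hΦ hΦ' (.of_abs_le f.2 hC)
  have h1 := map_mul (map_boxIndicator hΦ hR) hT
  have h2 := map_mul (map_boxIndicator hΦ' hR) hT'
  rw [one_mul] at h1 h2
  have e1 : T = S := ofBounded_injective (h1.symm.trans hS)
  have e2 : T' = S := ofBounded_injective (h2.symm.trans hS')
  exact ⟨S, e1 ▸ hT, e2 ▸ hT'⟩

/-- Both calculi agree on the bounded functions e = 1/(1 + |f|) and ef, and these determine the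
graph at f. -/
theorem eq_of_coord (hΦ : ∀ j, Φ.toFun (coord ℝ j) = ofBounded (A j))
    (hΦ' : ∀ j, Φ'.toFun (coord ℝ j) = ofBounded (A j)) : Φ = Φ' := by
  have hR : ∀ j, ‖A j‖ < ∑ i, ‖A i‖ + 1 := fun j =>
    (Finset.single_le_sum (fun i _ => norm_nonneg (A i)) (Finset.mem_univ j)).trans_lt
      (lt_add_one _)
  have key : Φ.toFun = Φ'.toFun := by
    funext f
    let e : MeasurableFunctions ℝ (Fin d → ℝ) := ⟨regularizer f.1, measurable_regularizer f.2⟩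
    let h : MeasurableFunctions ℝ (Fin d → ℝ) :=
      ⟨fun z => (regularizer f.1 z)⁻¹, Measurable.inv (measurable_regularizer f.2)⟩
    have he : h * e = 1 :=
      Subtype.ext (funext fun z => inv_mul_cancel₀ (regularizer_pos f.1 z).ne')
    obtain ⟨E, hE, hE'⟩ := eq_of_bounded hR hΦ hΦ' (f := e) (abs_regularizer_le f.1)
    obtain ⟨F, hF, hF'⟩ := eq_of_bounded hR hΦ hΦ' (f := e * f) (abs_regularizer_mul_le f.1)
    refine LinearPMap.eq_of_eq_graph (Submodule.ext fun ⟨x, y⟩ => ?_)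
    rw [mem_graph_iff he hE hF, mem_graph_iff he hE' hF']
  cases Φ
  cases Φ'
  congr

end Uniqueness

end MeasurableCalculus

end SpectralCalculus

theorem mainTheorem3 {H : Type*} [NormedAddCommGroup H] [InnerProductSpace ℝ H]
    [CompleteSpace H] (d : ℕ) (A : Fin d → (H →L[ℝ] H))
    (hsa : ∀ j, IsSelfAdjoint (A j)) (hcomm : ∀ i j, A i ∘L A j = A j ∘L A i) :
    ∃! Φ : SpectralCalculus.BorelCalculus ℝ (Fin d → ℝ) H,
      ∀ j, Φ.toFun (SpectralCalculus.coord ℝ j) = SpectralCalculus.ofBounded (A j) := by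
  obtain ⟨π, hπ⟩ := SpectralCalculus.exists_polynomial_calculus A hcomm
  -- One radius for all A_j; the added 1 keeps it positive even if d = 0 or every A_j is zero.
  have hR : 0 < ∑ i, ‖A i‖ + 1 := by positivity
  have hA : ∀ j, ‖π (MvPolynomial.X j)‖ ≤ ∑ i, ‖A i‖ + 1 := fun j => by
    rw [hπ]
    exact (Finset.single_le_sum (fun i _ => norm_nonneg (A i)) (Finset.mem_univ j)).trans
      (le_add_of_nonneg_right zero_le_one)
  obtain ⟨Ψ, hΨ, hcoord⟩ := SpectralCalculus.exists_isBoxCalculus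
    (fun j => (hπ j).symm ▸ hsa j) hR hA
  have hex : ∀ j, hΨ.toMeasurableCalculus.toFun (SpectralCalculus.coord ℝ j) =
      SpectralCalculus.ofBounded (A j) := fun j =>
    (hΨ.extend_of_bddOnBox (.coord j)).trans
      (congrArg SpectralCalculus.ofBounded ((hcoord j).trans (hπ j)))
  exact ⟨hΨ.toMeasurableCalculus, hex, fun Φ hΦ =>
    SpectralCalculus.MeasurableCalculus.eq_of_coord hΦ hex⟩
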